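/- Let $E$ be a complex Banach space and let $A:D(A)\subseteq E\to E$ be a closed linear operator, not necessarily densely defined, which satisfies the Hille--Yosida condition: there are $\omega,C\in\mathbb R$ such that every real $\lambda>\omega$ lies in the resolvent set of $A$ and $\|(\lambda-\omega)^kR(\lambda:A)^k\|\le C$ for all $\lambda>\omega$ and all integers $k\ge1$. Equip $D(A)$ with the graph norm $\|x\|+\|Ax\|$. Let $1\le p<\infty$, $\frac1p+\frac1q=1$, $s>1$, $h>0$, $0<T<\infty$. For a Banach space $X$ let $\tilde{\mathcal D}'^s_{L^p,h}(0,T;X)$ be the space of sequences $\mathbf f=(\mathbf F_\alpha)_{\alpha\in\mathbb N}$ in $L^p(0,T;X)$ with $$\|\mathbf f\|=\Big(\sum_{\alpha=0}^\infty\frac{\alpha!^{ps}}{h^{p\alpha}}\|\mathbf F_\alpha\|_{L^p(0,T;X)}^p\Big)^{1/p}<\infty .$$ Let $W^{1,p}(0,T;E)$ be the space of functions $\mathbf F(t)=F_0+\int_0^t\mathbf F'(r)\,dr$, $t\in[0,T]$, with $F_0\in E$ and $\mathbf F'\in L^p(0,T;E)$, and let $\tilde{\mathcal D}'^s_{W^{1,p},h}(0,T;E)$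 be the space of sequences $(\mathbf F_\alpha)_\alpha$ in $W^{1,p}(0,T;E)$ with $\sum_\alpha\frac{\alpha!^{ps}}{h^{p\alpha}}\big(\|\mathbf F_\alpha\|_{L^p}^p+\|\mathbf F_\alpha'\|_{L^p}^p\big)<\infty$; for such $\mathbf f=(\mathbf F_\alpha)_\alpha$ put $\mathbf f'=(\mathbf F_\alpha')_\alpha$. A sequence $(x_\alpha)_\alpha$ in $E$ is called weighted summable if $$\sum_{\alpha=0}^\infty\frac{\alpha!^{ps}}{h^{p\alpha}}\|x_\alpha\|^p<\infty ;$$ it is then identified with the sequence of constant functions $x_\alpha$ in $\tilde{\mathcal D}'^s_{L^p,h}(0,T;E)$. Let $\mathcal D^s_{L^q,h}(0,T)$ be the space of $\varphi\in\mathcal C^\infty(0,T)$ with $\big(\sum_\alpha\frac{h^{q\alpha}}{\alpha!^{qs}}\|\varphi^{(\alpha)}\|_{L^q(0,T)}^q\big)^{1/q}<\infty$ (if $q=\infty$: $\sup_\alpha\frac{h^\alpha}{\alpha!^s}\|\varphi^{(\alpha)}\|_{L^\infty(0,T)}<\infty$), and put $\langle\mathbf f,\varphi\rangle=\sum_\alpha(-1)^\alpha\int_0^T\mathbf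 F_\alpha(t)\varphi^{(\alpha)}(t)\,dt\in E$ for $\mathbf f\in\tilde{\mathcal D}'^s_{L^p,h}(0,T;E)$ and $\varphi\in\mathcal D^s_{L^q,h}(0,T)$. Consider the Cauchy problem $\mathbf u'=A\mathbf u+\mathbf f$, $\mathbf u(0)=u_0$, with $\mathbf f=(\mathbf F_\alpha)_\alpha\in\tilde{\mathcal D}'^s_{L^p,h}(0,T;E)$ and $u_0=(u_{0,\alpha})_\alpha$ in $E$. - A *strict solution* is $\mathbf u=(\mathbf U_\alpha)_\alpha\in\tilde{\mathcal D}'^s_{W^{1,p},h}(0,T;E)\cap\tilde{\mathcal D}'^s_{L^p,h}(0,T;D(A))$ such that, for all $\alpha$, $\mathbf U_\alpha'(t)=A\mathbf U_\alpha(t)+\mathbf F_\alpha(t)$ for a.e. $t\in[0,T]$ and $\mathbf U_\alpha(0)=u_{0,\alpha}$. A *strict weak solution* is $\mathbf u$ in the same intersection with $\mathbf U_\alpha(0)=u_{0,\alpha}$ for all $\alpha$, and with $\langle\mathbf u,\varphi\rangle\in D(A)$ and $\langle\mathbf u',\varphi\rangle=A\langle\mathbf u,\varphi\rangle+\langle\mathbf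 f,\varphi\rangle$ for all $\varphi\in\mathcal D^s_{L^q,h}(0,T)$. - An *$F$-solution* is $\mathbf u\in\tilde{\mathcal D}'^s_{L^p,h}(0,T;E)$ for which there are, for $k\in\mathbb N$, $\mathbf f_k\in\tilde{\mathcal D}'^s_{L^p,h}(0,T;E)$, sequences $u_{0,k}$ in $E$, and strict solutions $\mathbf u_k$ of the problem with data $\mathbf f_k,u_{0,k}$, such that $\|\mathbf u_k-\mathbf u\|+\|\mathbf f_k-\mathbf f\|+\|u_{0,k}-u_0\|\to0$ in the norm of $\tilde{\mathcal D}'^s_{L^p,h}(0,T;E)$. An *$F$-weak solution* is defined in the same way, with strict weak solutions $\mathbf u_k$, and with the convergence replaced by $\|\langle\mathbf u_k-\mathbf u,\varphi\rangle\|+\|\langle\mathbf f_k-\mathbf f,\varphi\rangle\|+\|\langle u_{0,k}-u_0,\varphi\rangle\|\to0$ for every $\varphi\in\mathcal D^s_{L^q,h}(0,T)$. **Theorem.** (i) For every $\mathbf f\in\tilde{\mathcal D}'^s_{L^p,h}(0,T;E)$ and every weighted summable $(u_{0,\alpha})_\alpha$ with $u_{0,\alpha}\in\overline{D(A)}$ for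 all $\alpha$, the Cauchy problem has exactly one $F$-solution, and it is also an $F$-weak solution. (ii) For every $\mathbf f=(\mathbf F_\alpha)_\alpha\in\tilde{\mathcal D}'^s_{W^{1,p},h}(0,T;E)$ and every $(u_{0,\alpha})_\alpha$ with $u_{0,\alpha}\in D(A)$ and $Au_{0,\alpha}+\mathbf F_\alpha(0)\in\overline{D(A)}$ for all $\alpha$, such that $(u_{0,\alpha})_\alpha$ and $(Au_{0,\alpha})_\alpha$ are both weighted summable, the Cauchy problem has exactly one strict solution, and it is also a strict weak solution. -/

import Mathlib

open Set Filter Topology MeasureTheory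
open scoped ENNReal

noncomputable section

namespace UltraCauchy

/-! ### Closed operators: graph norm, resolvent, Hille-Yosida condition -/

section Operator

variable {E : Type*} [NormedAddCommGroup E] [NormedSpace ℂ E]

/-- The domain `D(A)` of a partially defined operator, as a space of its own; it carries the graph
norm `‖u‖ + ‖A u‖`. -/
def GraphDomain (A : E →ₗ.[ℂ] E) : Type _ := A.domain

namespace GraphDomain

variable {A : E →ₗ.[ℂ] E}

instance : AddCommGroup (GraphDomain A) := inferInstanceAs (AddCommGroup A.domain)

instance : Module ℂ (GraphDomain A) := inferInstanceAs (Module ℂ A.domain)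

/-- Forget the graph norm. -/
def toDomain (x : GraphDomain A) : A.domain := x

/-- The embedding `u ↦ (u, A u)` into `E × E` with the norm `‖x‖ + ‖y‖`. -/
def toGraph (A : E →ₗ.[ℂ] E) : GraphDomain A →ₗ[ℂ] WithLp 1 (E × E) where
  toFun x := WithLp.toLp 1 ((x.toDomain : E), A x.toDomain)
  map_add' x y := by
    have h : (x + y).toDomain = x.toDomain + y.toDomain := rfl
    rw [h, A.map_add]
    rfl
  map_smul' c x := by
    have h : (c • x).toDomain = c • x.toDomain := rfl
    rw [h, A.map_smul]
    rfl

theorem toGraph_injective (A : E →ₗ.[ℂ] E) : Function.Injective (toGraph A) := by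
  intro x y h
  have h1 : (x.toDomain : E) = y.toDomain := congrArg (fun z => (WithLp.ofLp z).1) h
  exact Subtype.ext h1

instance : NormedAddCommGroup (GraphDomain A) :=
  NormedAddCommGroup.induced _ _ (toGraph A) (toGraph_injective A)

instance : NormedSpace ℂ (GraphDomain A) :=
  NormedSpace.induced ℂ _ _ (toGraph A)

theorem norm_eq (x : GraphDomain A) : ‖x‖ = ‖(x.toDomain : E)‖ + ‖A x.toDomain‖ := by
  change ‖toGraph A x‖ = _
  rw [WithLp.prod_norm_eq_of_L1]
  rfl

end GraphDomain

/-- `R` is the resolvent `R(z : A)`, the bounded everywhere defined two-sided inverse of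
`z - A : D(A) → E`. -/
def IsResolventAt (A : E →ₗ.[ℂ] E) (z : ℂ) (R : E →L[ℂ] E) : Prop :=
  (∀ x : E, ∃ hx : R x ∈ A.domain, z • R x - A ⟨R x, hx⟩ = x) ∧
    ∀ x : A.domain, R (z • (x : E) - A x) = x

/-- The Hille-Yosida condition with constants `ω` and `C`: every real `r > ω` lies in the resolvent
set of `A`, and `‖(r - ω) ^ k R(r : A) ^ k‖ ≤ C` for every integer `k ≥ 1`. -/
def HilleYosida (A : E →ₗ.[ℂ] E) (ω C : ℝ) : Prop :=
  ∀ r : ℝ, ω < r → ∃ R : E →L[ℂ] E, IsResolventAt A (r : ℂ) R ∧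
    ∀ k : ℕ, 1 ≤ k → ‖((r - ω : ℝ) : ℂ) ^ k • R ^ k‖ ≤ C

end Operator

/-! ### Function and sequence spaces -/

/-- Lebesgue measure on the interval `(0, T)`. -/
def intervalMeasure (T : ℝ) : Measure ℝ := volume.restrict (Ioo 0 T)

/-- The Bochner space `L^p(0, T; X)`. -/
abbrev LpI (X : Type*) [NormedAddCommGroup X] (p : ℝ≥0∞) (T : ℝ) : Type _ :=
  Lp X p (intervalMeasure T)

/-- The vector valued Sobolev space `W^{1,p}(0, T; E)`: its elements are the functions
`F(t) = F₀ + ∫_0^t F'(r) dr` on `[0, T]`, with `F₀ ∈ E` and `F' ∈ L^p(0, T; E)`. The function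
determines `F₀` and `F'`, see `W1p.ext_of_eqOn`. -/
structure W1p (E : Type*) [NormedAddCommGroup E] (p : ℝ≥0∞) (T : ℝ) where
  /-- the value at `0` -/
  init : E
  /-- the derivative -/
  der : LpI E p T

section Spaces

variable {X : Type*} [NormedAddCommGroup X]

/-- The weight `α!^{ps} / h^{pα}`. -/
def weight (p : ℝ≥0∞) (s h : ℝ) (α : ℕ) : ℝ :=
  (Nat.factorial α : ℝ) ^ (p.toReal * s) / h ^ (p.toReal * α)

/-- The norm `(∑_α α!^{ps} / h^{pα} ‖F_α‖_{L^p(0,T;X)}^p)^{1/p}`, with values in `[0, ∞]`, of a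
sequence of functions. -/
def seqNorm (p : ℝ≥0∞) (s h T : ℝ) (F : ℕ → ℝ → X) : ℝ≥0∞ :=
  (∑' α, ENNReal.ofReal (weight p s h α) *
    eLpNorm (F α) p (intervalMeasure T) ^ p.toReal) ^ (1 / p.toReal)

/-- The space `\tilde D'^s_{L^p,h}(0, T; X)`. -/
def SeqLp (X : Type*) [NormedAddCommGroup X] (p : ℝ≥0∞) (s h T : ℝ) : Set (ℕ → LpI X p T) :=
  {F | seqNorm p s h T (fun α => F α) < ∞}

/-- Weighted summability of a sequence of vectors:
`∑_α α!^{ps} / h^{pα} ‖x_α‖^p < ∞`. -/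
def WeightedSummable (p : ℝ≥0∞) (s h : ℝ) (x : ℕ → X) : Prop :=
  Summable fun α => weight p s h α * ‖x α‖ ^ p.toReal

end Spaces

section Sobolev

variable {E : Type*} [NormedAddCommGroup E] [NormedSpace ℂ E]

/-- The function `F(t) = F₀ + ∫_0^t F'(r) dr`, meant for `t ∈ [0, T]`. -/
def W1p.toFun {p : ℝ≥0∞} {T : ℝ} (F : W1p E p T) (t : ℝ) : E :=
  F.init + ∫ r in (0 : ℝ)..t, F.der r

instance (p : ℝ≥0∞) (T : ℝ) : CoeFun (W1p E p T) (fun _ => ℝ → E) where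
  coe F := F.toFun

theorem W1p.ext_of_eqOn [CompleteSpace E] {p : ℝ≥0∞} (hp : 1 ≤ p) {T : ℝ} (hT : 0 < T)
    {F G : W1p E p T} (h : EqOn F G (Icc 0 T)) : F = G := by
  have h0 : F.init = G.init := by simpa [W1p.toFun] using h (left_mem_Icc.2 hT.le)
  have hi : ∀ K : LpI E p T, IntegrableOn K (Ioo 0 T) := fun K =>
    haveI : IsFiniteMeasure (intervalMeasure T) := by unfold intervalMeasure; infer_instance
    (Lp.memLp K).integrable hp
  have hd : F.der =ᵐ[intervalMeasure T] G.der := by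
    have hv : ∀ K : LpI E p T, IntervalIntegrable K volume 0 T := fun K =>
      (intervalIntegrable_iff_integrableOn_Ioo_of_le hT.le).2 (hi K)
    have hz : (0 : ℝ) ∈ uIcc 0 T := left_mem_uIcc
    have h1 := (hv F.der).ae_hasDerivAt_integral
    have h2 := (hv G.der).ae_hasDerivAt_integral
    unfold intervalMeasure
    refine (ae_restrict_iff' measurableSet_Ioo).2 ?_
    filter_upwards [h1, h2] with t ht1 ht2 ht
    have htm : t ∈ uIcc 0 T := by rw [uIcc_of_le hT.le]; exact Ioo_subset_Icc_self ht
    refine (ht1 htm 0 hz).unique ((ht2 htm 0 hz).congr_of_eventuallyEq ?_)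
    filter_upwards [Ioo_mem_nhds ht.1 ht.2] with r hr
    have h3 : F.init + ∫ x in (0 : ℝ)..r, F.der x = G.init + ∫ x in (0 : ℝ)..r, G.der x :=
      h (Ioo_subset_Icc_self hr)
    rw [h0] at h3
    exact add_left_cancel h3
  cases F; cases G
  obtain rfl : _ = _ := h0
  obtain rfl := Lp.ext hd
  rfl

/-- The norm `(∑_α α!^{ps} / h^{pα} (‖F_α‖_{L^p}^p + ‖F_α'‖_{L^p}^p))^{1/p}`, with values in
`[0, ∞]`. -/
def seqSobolevNorm (p : ℝ≥0∞) (s h T : ℝ) (F : ℕ → W1p E p T) : ℝ≥0∞ :=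
  (∑' α, ENNReal.ofReal (weight p s h α) *
    (eLpNorm (F α) p (intervalMeasure T) ^ p.toReal +
      eLpNorm (F α).der p (intervalMeasure T) ^ p.toReal)) ^ (1 / p.toReal)

/-- The space `\tilde D'^s_{W^{1,p},h}(0, T; E)`. -/
def SeqW1p (E : Type*) [NormedAddCommGroup E] [NormedSpace ℂ E] (p : ℝ≥0∞) (s h T : ℝ) :
    Set (ℕ → W1p E p T) :=
  {F | seqSobolevNorm p s h T F < ∞}

/-- The space `\tilde D'^s_{W^{1,p},h}(0, T; E) ∩ \tilde D'^s_{L^p,h}(0, T; D(A))`. -/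
def SeqW1pDom (A : E →ₗ.[ℂ] E) (p : ℝ≥0∞) (s h T : ℝ) : Set (ℕ → W1p E p T) :=
  {U | U ∈ SeqW1p E p s h T ∧ ∃ V ∈ SeqLp (GraphDomain A) p s h T,
    ∀ α, ∀ᵐ t ∂intervalMeasure T, ((V α t).toDomain : E) = U α t}

/-! ### Test functions and the pairing -/

/-- The norm of `D^s_{L^q,h}(0, T)`, with values in `[0, ∞]`:
`(∑_α h^{qα} / α!^{qs} ‖φ^{(α)}‖_{L^q}^q)^{1/q}` for `q < ∞`, and
`sup_α h^α / α!^s ‖φ^{(α)}‖_{L^∞}` for `q = ∞`. -/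
def testNorm (q : ℝ≥0∞) (s h T : ℝ) (φ : ℝ → ℂ) : ℝ≥0∞ :=
  if q = ∞ then
    ⨆ α : ℕ, ENNReal.ofReal (h ^ α / (Nat.factorial α : ℝ) ^ s) *
      eLpNorm (iteratedDeriv α φ) ∞ (intervalMeasure T)
  else
    (∑' α : ℕ, ENNReal.ofReal (h ^ (q.toReal * α) / (Nat.factorial α : ℝ) ^ (q.toReal * s)) *
      eLpNorm (iteratedDeriv α φ) q (intervalMeasure T) ^ q.toReal) ^ (1 / q.toReal)

/-- The test space `D^s_{L^q,h}(0, T)`. Only the values of `φ` on the open interval matter. -/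
def TestSpace (q : ℝ≥0∞) (s h T : ℝ) : Set (ℝ → ℂ) :=
  {φ | ContDiffOn ℝ ((⊤ : ℕ∞) : WithTop ℕ∞) φ (Ioo 0 T) ∧ testNorm q s h T φ < ∞}

/-- The pairing `⟨f, φ⟩ = ∑_α (-1)^α ∫_0^T F_α(t) φ^{(α)}(t) dt ∈ E`. -/
def pairing (T : ℝ) (F : ℕ → ℝ → E) (φ : ℝ → ℂ) : E :=
  ∑' α : ℕ, (-1 : ℂ) ^ α • ∫ t, iteratedDeriv α φ t • F α t ∂intervalMeasure T

/-! ### Solutions of `u' = A u + f`, `u(0) = u₀` -/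

/-- Strict solutions. -/
def IsStrictSolution (A : E →ₗ.[ℂ] E) (p : ℝ≥0∞) (s h T : ℝ) (f : ℕ → ℝ → E) (u₀ : ℕ → E)
    (u : ℕ → W1p E p T) : Prop :=
  u ∈ SeqW1pDom A p s h T ∧
    (∀ α, ∀ᵐ t ∂intervalMeasure T,
      ∃ ht : u α t ∈ A.domain, (u α).der t = A ⟨u α t, ht⟩ + f α t) ∧
    ∀ α, u α 0 = u₀ α

/-- Strict weak solutions; `q` is the exponent of the test functions. -/
def IsStrictWeakSolution (A : E →ₗ.[ℂ] E) (p q : ℝ≥0∞) (s h T : ℝ) (f : ℕ → ℝ → E) (u₀ : ℕ → E)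
    (u : ℕ → W1p E p T) : Prop :=
  u ∈ SeqW1pDom A p s h T ∧
    (∀ φ ∈ TestSpace q s h T, ∃ hφ : pairing T (fun α => u α) φ ∈ A.domain,
      pairing T (fun α => (u α).der) φ = A ⟨pairing T (fun α => u α) φ, hφ⟩ + pairing T f φ) ∧
    ∀ α, u α 0 = u₀ α

/-- `F`-solutions: limits of strict solutions, with convergence of the data, in the norm of
`\tilde D'^s_{L^p,h}(0, T; E)`. -/
def IsFSolution (A : E →ₗ.[ℂ] E) (p : ℝ≥0∞) (s h T : ℝ) (f : ℕ → ℝ → E) (u₀ : ℕ → E)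
    (u : ℕ → LpI E p T) : Prop :=
  u ∈ SeqLp E p s h T ∧
    ∃ (uk : ℕ → ℕ → W1p E p T) (fk : ℕ → ℕ → LpI E p T) (u₀k : ℕ → ℕ → E),
      (∀ k, fk k ∈ SeqLp E p s h T ∧
        IsStrictSolution A p s h T (fun α => fk k α) (u₀k k) (uk k)) ∧
      Tendsto (fun k =>
          seqNorm p s h T (fun α t => uk k α t - u α t) +
          seqNorm p s h T (fun α t => fk k α t - f α t) +
          seqNorm p s h T (fun α _ => u₀k k α - u₀ α)) atTop (𝓝 0)

/-- `F`-weak solutions: limits of strict weak solutions, with convergence of the data, after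
pairing with each test function. -/
def IsFWeakSolution (A : E →ₗ.[ℂ] E) (p q : ℝ≥0∞) (s h T : ℝ) (f : ℕ → ℝ → E) (u₀ : ℕ → E)
    (u : ℕ → LpI E p T) : Prop :=
  u ∈ SeqLp E p s h T ∧
    ∃ (uk : ℕ → ℕ → W1p E p T) (fk : ℕ → ℕ → LpI E p T) (u₀k : ℕ → ℕ → E),
      (∀ k, fk k ∈ SeqLp E p s h T ∧
        IsStrictWeakSolution A p q s h T (fun α => fk k α) (u₀k k) (uk k)) ∧
      ∀ φ ∈ TestSpace q s h T, Tendsto (fun k =>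
          ‖pairing T (fun α t => uk k α t - u α t) φ‖ +
          ‖pairing T (fun α t => fk k α t - f α t) φ‖ +
          ‖pairing T (fun α _ => u₀k k α - u₀ α) φ‖) atTop (𝓝 0)

end Sobolev

end UltraCauchy

end

/-!
Component by component this is the Cauchy problem `w' = A w + F` in `L^p(0, T; E)`, to be solved
with bounds uniform in the component. As `A` need not be densely defined, it generates no semigroup
on `E`. Its Yosida approximations `B_n = λ_n A R(λ_n : A)` do, with exponentials bounded on `[0, T]`
uniformly in `n`. When `v₀` lies in the closure of `D(A)`, the solutions of `v' = B_n v + g`,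
`v(0) = v₀` converge to some `v`. For `v₀ = A u₀ + F(0)` and `g = F'` this `v` is the derivative of
the strict solution with data `F` and `u₀`.

Conversely the derivative of a strict solution `w` lies almost everywhere in the closure of `D(A)`,
where `J_n = λ_n R(λ_n : A)` converges to the identity. Now `A w = w' - F` gives
`w' = B_n w + J_n F + (w' - J_n w')`, and `n → ∞` in the bounds for `B_n` yields
`‖w‖ ≤ K (‖w(0)‖ + ‖F‖)`. So the solution operator `(F, u₀) ↦ w` extends to the closure of its
domain, which contains all `F` in `L^p` and all `u₀` in the closure of `D(A)`.

The estimates pass to the weighted `ℓ^p` sums because `K` does not depend on the component. A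
sequence in such a space is approximated by its truncations, so that only finitely many components
have to be approximated at a time. For weak solutions, a resolvent of `A` turns membership in the
graph of `A` into an equation between bounded operators, which commutes with integrals and sums and
hence with the pairing.
-/

noncomputable section

namespace UltraCauchy

open scoped NNReal

/-! ### Exponentials in Banach algebras -/

section Exponential

variable {𝔸 : Type*} [NormedRing 𝔸] [NormedAlgebra ℝ 𝔸]

theorem norm_exp_smul_le_of_norm_pow_le {a : 𝔸} {t C ρ : ℝ} (ht : 0 ≤ t)
    (ha : ∀ k : ℕ, ‖a ^ k‖ ≤ C * ρ ^ k) : ‖NormedSpace.exp (t • a)‖ ≤ C * Real.exp (t * ρ) := by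
  have hsum : HasSum (fun n : ℕ => C * ((t * ρ) ^ n / n.factorial)) (C * Real.exp (t * ρ)) := by
    rw [Real.exp_eq_exp_ℝ]
    exact (NormedSpace.expSeries_div_hasSum_exp (t * ρ)).mul_left C
  rw [NormedSpace.exp_eq_tsum ℝ]
  refine tsum_of_norm_bounded hsum fun n => ?_
  calc ‖(n.factorial⁻¹ : ℝ) • (t • a) ^ n‖ = (n.factorial : ℝ)⁻¹ * (t ^ n * ‖a ^ n‖) := by
        rw [smul_pow, norm_smul, norm_smul, norm_pow, norm_inv, Real.norm_of_nonneg ht,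
          RCLike.norm_natCast]
    _ ≤ (n.factorial : ℝ)⁻¹ * (t ^ n * (C * ρ ^ n)) := by gcongr; exact ha n
    _ = C * ((t * ρ) ^ n / n.factorial) := by rw [mul_pow]; ring

variable [CompleteSpace 𝔸]

theorem exp_add_of_commute {a b : 𝔸} (h : Commute a b) :
    NormedSpace.exp (a + b) = NormedSpace.exp a * NormedSpace.exp b :=
  letI := NormedAlgebra.restrictScalars ℚ ℝ 𝔸
  NormedSpace.exp_add_of_commute h

theorem exp_add_smul (s t : ℝ) (a : 𝔸) :
    NormedSpace.exp ((s + t) • a) = NormedSpace.exp (s • a) * NormedSpace.exp (t • a) := by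
  rw [add_smul, exp_add_of_commute (((Commute.refl a).smul_left s).smul_right t)]

theorem exp_smul_smul_sub_one (t l : ℝ) (a : 𝔸) :
    NormedSpace.exp (t • l • (a - 1)) = Real.exp (-(t * l)) • NormedSpace.exp ((t * l) • a) := by
  have h : t • l • (a - 1) = algebraMap ℝ 𝔸 (-(t * l)) + (t * l) • a := by
    rw [Algebra.algebraMap_eq_smul_one]; module
  rw [h, exp_add_of_commute (Algebra.commutes _ _), ← NormedSpace.algebraMap_exp_comm,
    ← Real.exp_eq_exp_ℝ, ← Algebra.smul_def]

theorem norm_exp_smul_yosida_le {a : 𝔸} {ω r C t : ℝ} (hr : 2 * |ω| < r) (ht : 0 ≤ t)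
    (ha : ∀ k : ℕ, ‖a ^ k‖ ≤ C * ((r - ω)⁻¹) ^ k) :
    ‖NormedSpace.exp (t • r • (r • a - 1))‖ ≤ C * Real.exp (t * (2 * |ω|)) := by
  have hω := le_abs_self ω
  have hω0 := abs_nonneg ω
  have hr0 : 0 < r := by linarith
  have hsub : 0 < r - ω := by linarith
  have hC : 0 ≤ C := by simpa using (norm_nonneg _).trans (ha 0)
  have hpow : ∀ k : ℕ, ‖(r • a) ^ k‖ ≤ C * (r * (r - ω)⁻¹) ^ k := fun k => by
    rw [smul_pow, norm_smul, norm_pow, Real.norm_of_nonneg hr0.le, mul_pow, mul_left_comm]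
    exact mul_le_mul_of_nonneg_left (ha k) (by positivity)
  have hexponent : -(t * r) + t * r * (r * (r - ω)⁻¹) ≤ t * (2 * |ω|) := by
    have hratio : r * (r - ω)⁻¹ ≤ 2 := by
      rw [← div_eq_mul_inv, div_le_iff₀ hsub]; linarith
    calc -(t * r) + t * r * (r * (r - ω)⁻¹) = t * (r * (r - ω)⁻¹ * ω) := by field_simp; ring
      _ ≤ t * (r * (r - ω)⁻¹ * |ω|) := by gcongr
      _ ≤ t * (2 * |ω|) := by gcongr
  rw [exp_smul_smul_sub_one, norm_smul, Real.norm_of_nonneg (Real.exp_pos _).le]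
  calc Real.exp (-(t * r)) * ‖NormedSpace.exp ((t * r) • r • a)‖
      ≤ Real.exp (-(t * r)) * (C * Real.exp (t * r * (r * (r - ω)⁻¹))) := by
        gcongr; exact norm_exp_smul_le_of_norm_pow_le (by positivity) hpow
    _ = C * Real.exp (-(t * r) + t * r * (r * (r - ω)⁻¹)) := by rw [Real.exp_add]; ring
    _ ≤ C * Real.exp (t * (2 * |ω|)) := by gcongr

theorem continuous_exp_smul (a : 𝔸) : Continuous fun t : ℝ => NormedSpace.exp (t • a) :=
  continuous_iff_continuousAt.2 fun t => (hasDerivAt_exp_smul_const a t).continuousAt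

theorem hasDerivAt_exp_neg_smul (a : 𝔸) (t : ℝ) :
    HasDerivAt (fun s : ℝ => NormedSpace.exp ((-s) • a)) (-(NormedSpace.exp ((-t) • a) * a)) t := by
  have h := (hasDerivAt_exp_smul_const a (-t)).scomp t (hasDerivAt_neg t)
  rwa [neg_one_smul] at h

end Exponential

/-! ### Integration by parts for operator valued functions -/

section IntegrationByParts

variable {E F : Type*} [NormedAddCommGroup E] [NormedSpace ℝ E] [NormedAddCommGroup F]
  [NormedSpace ℝ F]

theorem intervalIntegrable_clm_apply {Φ : ℝ → E →L[ℝ] F} {g : ℝ → E} {a b : ℝ}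
    (hΦ : Continuous Φ) (hg : IntervalIntegrable g volume a b) :
    IntervalIntegrable (fun s => Φ s (g s)) volume a b := by
  obtain ⟨c, hc⟩ := isCompact_uIcc.exists_bound_of_continuousOn (s := uIcc a b) hΦ.continuousOn
  rw [intervalIntegrable_iff] at hg ⊢
  refine (hg.norm.const_mul c).mono' ?_ ?_
  · exact isBoundedBilinearMap_apply.continuous.comp_aestronglyMeasurable
      (hΦ.aestronglyMeasurable.prodMk hg.aestronglyMeasurable)
  · exact (ae_restrict_iff' measurableSet_uIoc).2 (.of_forall fun s hs =>
      (Φ s).le_of_opNorm_le (hc s (uIoc_subset_uIcc hs)) _)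

theorem norm_intervalIntegral_clm_apply_le {Φ : ℝ → E →L[ℝ] F} {g : ℝ → E} {a b c : ℝ}
    (hab : a ≤ b) (hΦ : ∀ s ∈ Icc a b, ‖Φ s‖ ≤ c) (hg : IntervalIntegrable g volume a b) :
    ‖∫ s in a..b, Φ s (g s)‖ ≤ c * ∫ s in a..b, ‖g s‖ := by
  rw [← intervalIntegral.integral_const_mul]
  exact intervalIntegral.norm_integral_le_of_norm_le hab
    (.of_forall fun s hs => (Φ s).le_of_opNorm_le (hΦ s (Ioc_subset_Icc_self hs)) _)
    (hg.norm.const_mul c)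

theorem continuousOn_primitive_Icc {g : ℝ → E} {a b : ℝ} (hab : a ≤ b)
    (hg : IntervalIntegrable g volume a b) :
    ContinuousOn (fun s => ∫ r in a..s, g r) (Icc a b) := by
  simpa only [uIcc_of_le hab] using
    intervalIntegral.continuousOn_primitive_interval' hg left_mem_uIcc

theorem intervalIntegrable_of_mem_Icc {G : Type*} [NormedAddCommGroup G] {g : ℝ → G}
    {a b t : ℝ} (ht : t ∈ Icc a b) (hg : IntervalIntegrable g volume a b) :
    IntervalIntegrable g volume a t :=
  hg.mono_set (by
    rw [uIcc_of_le ht.1, uIcc_of_le (ht.1.trans ht.2)]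
    exact Icc_subset_Icc_right ht.2)

variable [CompleteSpace E] [CompleteSpace F]

theorem integral_clm_apply_primitive {Ψ : ℝ → E →L[ℝ] F} {g : ℝ → E} {a b : ℝ} (hab : a ≤ b)
    (hΨ : IntervalIntegrable Ψ volume a b) (hg : IntervalIntegrable g volume a b) :
    ∫ s in a..b, Ψ s (∫ r in a..s, g r) = ∫ r in a..b, (∫ s in r..b, Ψ s) (g r) := by
  let K : ℝ → ℝ → F := fun s r => (Iic s).indicator (fun r => Ψ s (g r)) r
  have hprod : Integrable (Function.uncurry K)
      ((volume.restrict (Ioc a b)).prod (volume.restrict (Ioc a b))) := by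
    have h := Integrable.op_fst_snd (op := fun (L : E →L[ℝ] F) x => L x)
      isBoundedBilinearMap_apply.continuous ⟨1, fun L x => by simpa using L.le_opNorm x⟩ hΨ.1 hg.1
    exact h.indicator (s := {p : ℝ × ℝ | p.2 ≤ p.1})
      (measurableSet_le measurable_snd measurable_fst)
  have hleft : ∀ s ∈ Ioc a b, ∫ r in Ioc a b, K s r = Ψ s (∫ r in a..s, g r) := fun s hs => by
    rw [setIntegral_indicator measurableSet_Iic, Ioc_inter_Iic, inf_eq_right.2 hs.2,
      ← intervalIntegral.integral_of_le hs.1.le]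
    exact (Ψ s).intervalIntegral_comp_comm
      (intervalIntegrable_of_mem_Icc (Ioc_subset_Icc_self hs) hg)
  have hright : ∀ r ∈ Ioc a b, ∫ s in Ioc a b, K s r = (∫ s in r..b, Ψ s) (g r) := fun r hr => by
    have hK : (fun s => K s r) = (Ici r).indicator fun s => Ψ s (g r) := by
      ext s; simp only [K, indicator_apply, mem_Iic, mem_Ici]
    have hset : Ioc a b ∩ Ici r = Icc r b := by
      ext s; simp only [mem_inter_iff, mem_Ioc, mem_Ici, mem_Icc]
      exact ⟨fun h => ⟨h.2, h.1.2⟩, fun h => ⟨⟨hr.1.trans_le h.1, h.2⟩, h.1⟩⟩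
    have hΨr : IntegrableOn Ψ (Ioc r b) := hΨ.1.mono_set (Ioc_subset_Ioc_left hr.1.le)
    rw [hK, setIntegral_indicator measurableSet_Ici, hset, integral_Icc_eq_integral_Ioc,
      intervalIntegral.integral_of_le hr.2, ContinuousLinearMap.integral_apply hΨr]
  rw [intervalIntegral.integral_of_le hab, intervalIntegral.integral_of_le hab,
    ← setIntegral_congr_fun measurableSet_Ioc hleft, integral_integral_swap hprod,
    setIntegral_congr_fun measurableSet_Ioc hright]

theorem integral_clm_apply_eq_sub {Φ Φ' : ℝ → E →L[ℝ] F} (hΦ : ∀ s, HasDerivAt Φ (Φ' s) s)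
    (hΦ' : Continuous Φ') {g : ℝ → E} {a b : ℝ} (hab : a ≤ b)
    (hg : IntervalIntegrable g volume a b) (w₀ : E) :
    ∫ s in a..b, Φ s (g s) = Φ b (w₀ + ∫ s in a..b, g s) - Φ a w₀ -
      ∫ s in a..b, Φ' s (w₀ + ∫ r in a..s, g r) := by
  have hΦc : Continuous Φ := continuous_iff_continuousAt.2 fun s => (hΦ s).continuousAt
  have hFTC : ∀ r, ∫ s in r..b, Φ' s = Φ b - Φ r := fun r =>
    intervalIntegral.integral_eq_sub_of_hasDerivAt (fun s _ => hΦ s) (hΦ'.intervalIntegrable r b)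
  have hinit : ∫ s in a..b, Φ' s w₀ = Φ b w₀ - Φ a w₀ := by
    rw [← ContinuousLinearMap.intervalIntegral_apply (hΦ'.intervalIntegrable a b), hFTC,
      sub_apply]
  have hprimitive : ∫ s in a..b, Φ' s (∫ r in a..s, g r) =
      Φ b (∫ s in a..b, g s) - ∫ s in a..b, Φ s (g s) := by
    rw [integral_clm_apply_primitive hab (hΦ'.intervalIntegrable a b) hg]
    simp only [hFTC, sub_apply]
    rw [intervalIntegral.integral_sub
      (intervalIntegrable_clm_apply continuous_const hg) (intervalIntegrable_clm_apply hΦc hg),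
      (Φ b).intervalIntegral_comp_comm hg]
  simp only [map_add]
  rw [intervalIntegral.integral_add
      (intervalIntegrable_clm_apply hΦ' intervalIntegrable_const)
      (intervalIntegrable_clm_apply hΦ'
        ((continuousOn_primitive_Icc hab hg).intervalIntegrable_of_Icc hab)),
    hinit, hprimitive]
  abel

end IntegrationByParts

/-! ### The variation of constants formula for a bounded generator -/

section Duhamel

variable {E : Type*} [NormedAddCommGroup E] [NormedSpace ℝ E]

/-- The convolution `∫_0^t e^{(t - s) B} g(s) ds`, that is, the mild solution of `v' = B v + g`,
`v(0) = 0`. -/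
def duhamel (B : E →L[ℝ] E) (g : ℝ → E) (t : ℝ) : E :=
  ∫ s in (0 : ℝ)..t, NormedSpace.exp ((t - s) • B) (g s)

theorem norm_duhamel_le {B : E →L[ℝ] E} {M T : ℝ}
    (hM : ∀ t ∈ Icc 0 T, ‖NormedSpace.exp (t • B)‖ ≤ M) {g : ℝ → E} {t : ℝ} (ht : t ∈ Icc 0 T)
    (hg : IntervalIntegrable g volume 0 t) : ‖duhamel B g t‖ ≤ M * ∫ s in (0 : ℝ)..t, ‖g s‖ :=
  norm_intervalIntegral_clm_apply_le ht.1
    (fun s hs => hM _ ⟨sub_nonneg.2 hs.2, by linarith [hs.1, ht.2]⟩) hg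

theorem exp_smul_apply_comm {B R : E →L[ℝ] E} (h : Commute R B) (t : ℝ) (x : E) :
    R (NormedSpace.exp (t • B) x) = NormedSpace.exp (t • B) (R x) :=
  DFunLike.congr_fun (h.smul_right t).exp_right.eq x

variable [CompleteSpace E]

theorem exp_add_smul_apply (B : E →L[ℝ] E) (s t : ℝ) (x : E) :
    NormedSpace.exp ((s + t) • B) x = NormedSpace.exp (s • B) (NormedSpace.exp (t • B) x) :=
  DFunLike.congr_fun (exp_add_smul s t B) x

theorem exp_smul_exp_neg_smul (B : E →L[ℝ] E) (t : ℝ) (x : E) :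
    NormedSpace.exp (t • B) (NormedSpace.exp ((-t) • B) x) = x := by
  rw [← exp_add_smul_apply, add_neg_cancel, zero_smul, NormedSpace.exp_zero, one_apply_eq_self]

variable {B : E →L[ℝ] E}

theorem intervalIntegrable_exp_apply {g : ℝ → E} {a b : ℝ} (hg : IntervalIntegrable g volume a b)
    (t : ℝ) : IntervalIntegrable (fun s => NormedSpace.exp ((t - s) • B) (g s)) volume a b :=
  intervalIntegrable_clm_apply ((continuous_exp_smul B).comp (continuous_sub_left t)) hg

theorem duhamel_sub {g k : ℝ → E} {t : ℝ} (hg : IntervalIntegrable g volume 0 t)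
    (hk : IntervalIntegrable k volume 0 t) :
    duhamel B (fun s => g s - k s) t = duhamel B g t - duhamel B k t := by
  simp only [duhamel, map_sub]
  exact intervalIntegral.integral_sub (intervalIntegrable_exp_apply hg t)
    (intervalIntegrable_exp_apply hk t)

theorem duhamel_apply_comm {R : E →L[ℝ] E} (h : Commute R B) {g : ℝ → E} {t : ℝ}
    (hg : IntervalIntegrable g volume 0 t) :
    R (duhamel B g t) = duhamel B (fun s => R (g s)) t := by
  rw [duhamel, ← R.intervalIntegral_comp_comm (intervalIntegrable_exp_apply hg t)]
  exact intervalIntegral.integral_congr fun s _ => exp_smul_apply_comm h (t - s) (g s)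

theorem exp_add_duhamel {g : ℝ → E} {t : ℝ} (hg : IntervalIntegrable g volume 0 t) (x : E) :
    NormedSpace.exp (t • B) x + duhamel B g t = NormedSpace.exp (t • B)
      (x + ∫ s in (0 : ℝ)..t, NormedSpace.exp ((-s) • B) (g s)) := by
  have h := intervalIntegrable_exp_apply (B := B) hg 0
  simp only [zero_sub] at h
  rw [map_add, ← ContinuousLinearMap.intervalIntegral_comp_comm _ h]
  simp only [duhamel, sub_eq_add_neg, exp_add_smul_apply]

theorem continuousOn_exp_add_duhamel {g : ℝ → E} {T : ℝ} (hT : 0 ≤ T)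
    (hg : IntervalIntegrable g volume 0 T) (x : E) :
    ContinuousOn (fun t => NormedSpace.exp (t • B) x + duhamel B g t) (Icc 0 T) := by
  have h := intervalIntegrable_exp_apply (B := B) hg 0
  simp only [zero_sub] at h
  exact ((continuous_exp_smul B).continuousOn.clm_apply
    (continuousOn_const.add (continuousOn_primitive_Icc hT h))).congr fun t ht =>
      exp_add_duhamel (intervalIntegrable_of_mem_Icc ht hg) x

theorem eq_exp_add_duhamel {g : ℝ → E} {w₀ : E} {t : ℝ} (ht : 0 ≤ t)
    (hg : IntervalIntegrable g volume 0 t) :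
    w₀ + ∫ s in (0 : ℝ)..t, g s = NormedSpace.exp (t • B) w₀ +
      duhamel B (fun s => g s - B (w₀ + ∫ r in (0 : ℝ)..s, g r)) t := by
  set w : ℝ → E := fun s => w₀ + ∫ r in (0 : ℝ)..s, g r
  have hexp : Continuous fun s : ℝ => NormedSpace.exp ((-s) • B) :=
    (continuous_exp_smul B).comp continuous_neg
  have hBw : IntervalIntegrable (fun s => B (w s)) volume 0 t :=
    intervalIntegrable_clm_apply continuous_const
      ((continuousOn_const.add (continuousOn_primitive_Icc ht hg)).intervalIntegrable_of_Icc ht)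
  have hparts := integral_clm_apply_eq_sub (hasDerivAt_exp_neg_smul B)
    (hexp.mul continuous_const).neg ht hg w₀
  simp only [neg_zero, zero_smul, NormedSpace.exp_zero, one_apply_eq_self,
    neg_apply, mul_apply_eq_comp, intervalIntegral.integral_neg,
    sub_neg_eq_add] at hparts
  rw [exp_add_duhamel (hg.sub hBw)]
  simp only [map_sub]
  rw [intervalIntegral.integral_sub (intervalIntegrable_clm_apply hexp hg)
    (intervalIntegrable_clm_apply hexp hBw), hparts, add_sub_cancel_right, add_sub_cancel,
    exp_smul_exp_neg_smul]

theorem exp_add_duhamel_eq {g : ℝ → E} {v₀ : E} {t : ℝ} (ht : 0 ≤ t)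
    (hg : IntervalIntegrable g volume 0 t) :
    NormedSpace.exp (t • B) v₀ + duhamel B g t = v₀ + (∫ s in (0 : ℝ)..t, g s) +
      B (∫ s in (0 : ℝ)..t, (NormedSpace.exp (s • B) v₀ + duhamel B g s)) := by
  have hk : IntervalIntegrable (fun s => NormedSpace.exp ((-s) • B) (g s)) volume 0 t :=
    intervalIntegrable_clm_apply ((continuous_exp_smul B).comp continuous_neg) hg
  have hparts := integral_clm_apply_eq_sub (hasDerivAt_exp_smul_const' B)
    (continuous_const.mul (continuous_exp_smul B)) ht hk v₀
  simp only [exp_smul_exp_neg_smul, zero_smul, NormedSpace.exp_zero,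
    one_apply_eq_self, mul_apply_eq_comp] at hparts
  have hv : IntervalIntegrable (fun s => NormedSpace.exp (s • B) v₀ + duhamel B g s) volume 0 t :=
    (continuousOn_exp_add_duhamel ht hg v₀).intervalIntegrable_of_Icc ht
  have hB : ∫ s in (0 : ℝ)..t, B (NormedSpace.exp (s • B)
        (v₀ + ∫ r in (0 : ℝ)..s, NormedSpace.exp ((-r) • B) (g r))) =
      B (∫ s in (0 : ℝ)..t, (NormedSpace.exp (s • B) v₀ + duhamel B g s)) := by
    rw [← B.intervalIntegral_comp_comm hv]
    refine intervalIntegral.integral_congr fun s hs => ?_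
    rw [uIcc_of_le ht] at hs
    exact congrArg B (exp_add_duhamel (intervalIntegrable_of_mem_Icc hs hg) v₀).symm
  rw [exp_add_duhamel hg, ← hB, hparts]
  abel

end Duhamel

/-! ### Resolvents and Yosida approximations -/

section Resolvent

variable {E : Type*} [NormedAddCommGroup E] [NormedSpace ℂ E] {A : E →ₗ.[ℂ] E}

theorem IsResolventAt.apply_of_mem_graph {z : ℂ} {R : E →L[ℂ] E} (h : IsResolventAt A z R)
    {x y : E} (hxy : (x, y) ∈ A.graph) : R (z • x - y) = x := by
  obtain ⟨w, rfl, rfl⟩ := (LinearPMap.mem_graph_iff A).1 hxy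
  exact h.2 w

theorem IsResolventAt.mem_graph {z : ℂ} {R : E →L[ℂ] E} (h : IsResolventAt A z R) (x : E) :
    (R x, z • R x - x) ∈ A.graph := by
  obtain ⟨hx, hRx⟩ := h.1 x
  exact (LinearPMap.mem_graph_iff A).2
    ⟨⟨R x, hx⟩, rfl, (sub_eq_of_eq_add (sub_eq_iff_eq_add'.1 hRx)).symm⟩

theorem IsResolventAt.mem_graph_iff {z : ℂ} {R : E →L[ℂ] E} (h : IsResolventAt A z R) {x y : E} :
    (x, y) ∈ A.graph ↔ R (z • x - y) = x := by
  refine ⟨h.apply_of_mem_graph, fun hR => ?_⟩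
  simpa only [hR, sub_sub_cancel] using h.mem_graph (z • x - y)

theorem HilleYosida.exists_norm_pow_le {ω C r : ℝ} (h : HilleYosida A ω C) (hr : ω < r) :
    ∃ R : E →L[ℂ] E, IsResolventAt A r R ∧ ∀ k : ℕ, ‖R ^ k‖ ≤ max 1 C * ((r - ω)⁻¹) ^ k := by
  obtain ⟨R, hR, hpow⟩ := h r hr
  have hsub : 0 < r - ω := sub_pos.2 hr
  refine ⟨R, hR, fun k => ?_⟩
  rcases k.eq_zero_or_pos with rfl | hk
  · simpa [ContinuousLinearMap.one_def] using
      (ContinuousLinearMap.norm_id_le (𝕜 := ℂ) (E := E)).trans (le_max_left 1 C)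
  · have hk := hpow k hk
    rw [norm_smul, norm_pow, Complex.norm_real, Real.norm_of_nonneg hsub.le] at hk
    rw [inv_pow, ← div_eq_mul_inv, le_div_iff₀ (by positivity), mul_comm]
    exact hk.trans (le_max_right _ _)

/-- Resolvents `R(λ_n : A)` along a sequence of positive reals `λ_n → ∞`, with the uniform bounds
on `λ_n R(λ_n : A)` and on the semigroups of the Yosida approximations on `[0, T]`. The operators
are regarded as real linear ones, so that they can be differentiated and integrated in time. -/
structure YosidaSystem (A : E →ₗ.[ℂ] E) (T : ℝ) (M : ℝ≥0) where
  lam : ℕ → ℝ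
  R : ℕ → E →L[ℝ] E
  lam_pos : ∀ n, 0 < lam n
  tendsto_lam : Tendsto lam atTop atTop
  mem_graph_iff : ∀ n {x y : E}, (x, y) ∈ A.graph ↔ R n (lam n • x - y) = x
  norm_smul_R_le : ∀ n, ‖lam n • R n‖ ≤ M
  norm_exp_le : ∀ n, ∀ t ∈ Icc 0 T,
    ‖NormedSpace.exp (t • lam n • (lam n • R n - 1))‖ ≤ M

theorem HilleYosida.exists_yosidaSystem [CompleteSpace E] {ω C : ℝ} (h : HilleYosida A ω C)
    (T : ℝ) : ∃ M, Nonempty (YosidaSystem A T M) := by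
  set lam : ℕ → ℝ := fun n => n + (2 * |ω| + 1)
  have hlam : ∀ n, 2 * |ω| < lam n := fun n => by
    linarith [(n.cast_nonneg : (0 : ℝ) ≤ n)]
  have hω : ∀ n, ω < lam n := fun n => by linarith [hlam n, le_abs_self ω, abs_nonneg ω]
  have hpos : ∀ n, 0 < lam n := fun n => by linarith [hlam n, abs_nonneg ω]
  choose R hR hpow using fun n => h.exists_norm_pow_le (hω n)
  set c : ℝ := max 1 C
  have hpow_real : ∀ n k, ‖(R n).restrictScalars ℝ ^ k‖ ≤ c * ((lam n - ω)⁻¹) ^ k := fun n k => by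
    rw [show (R n).restrictScalars ℝ ^ k = (R n ^ k).restrictScalars ℝ by ext x; simp,
      ContinuousLinearMap.norm_restrictScalars]
    exact hpow n k
  refine ⟨(max (2 * c) (c * Real.exp (T * (2 * |ω|)))).toNNReal, ⟨
    { lam := lam
      R := fun n => (R n).restrictScalars ℝ
      lam_pos := hpos
      tendsto_lam := tendsto_atTop_add_const_right _ _ tendsto_natCast_atTop_atTop
      mem_graph_iff := fun n x y => by
        rw [(hR n).mem_graph_iff, Complex.coe_smul, ContinuousLinearMap.coe_restrictScalars']
      norm_smul_R_le := fun n => le_max_of_le_left (le_max_of_le_left ?_)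
      norm_exp_le := fun n t ht => le_max_of_le_left (le_max_of_le_right ?_) }⟩⟩
  · have hsub : 0 < lam n - ω := sub_pos.2 (hω n)
    have hR1 := hpow_real n 1
    rw [pow_one, pow_one, ← div_eq_mul_inv, le_div_iff₀ hsub] at hR1
    rw [norm_smul, Real.norm_of_nonneg (hpos n).le]
    nlinarith [hlam n, le_abs_self ω, norm_nonneg ((R n).restrictScalars ℝ)]
  · refine (norm_exp_smul_yosida_le (hlam n) ht.1 (hpow_real n)).trans ?_
    gcongr
    exact ht.2

namespace YosidaSystem

variable {T : ℝ} {M : ℝ≥0} (Y : YosidaSystem A T M)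

/-- The operators `λ_n R(λ_n : A)`, which approximate the identity on the closure of `D(A)`. -/
def J (n : ℕ) : E →L[ℝ] E := Y.lam n • Y.R n

/-- The Yosida approximations `A λ_n R(λ_n : A) = λ_n (λ_n R(λ_n : A) - 1)` of `A`. -/
def B (n : ℕ) : E →L[ℝ] E := Y.lam n • (Y.J n - 1)

/-- The semigroups generated by the Yosida approximations. -/
def S (n : ℕ) (t : ℝ) : E →L[ℝ] E := NormedSpace.exp (t • Y.B n)

theorem J_apply (n : ℕ) (x : E) : Y.J n x = Y.lam n • Y.R n x := rfl

theorem B_apply (n : ℕ) (x : E) : Y.B n x = Y.lam n • (Y.J n x - x) := rfl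

theorem norm_S_le (n : ℕ) {t : ℝ} (ht : t ∈ Icc 0 T) : ‖Y.S n t‖ ≤ M := Y.norm_exp_le n t ht

theorem norm_J_apply_le (n : ℕ) (x : E) : ‖Y.J n x‖ ≤ M * ‖x‖ :=
  (Y.J n).le_of_opNorm_le (Y.norm_smul_R_le n) x

theorem norm_S_apply_le (n : ℕ) {t : ℝ} (ht : t ∈ Icc 0 T) (x : E) : ‖Y.S n t x‖ ≤ M * ‖x‖ :=
  (Y.S n t).le_of_opNorm_le (Y.norm_S_le n ht) x

theorem R_mem_graph (n : ℕ) (x : E) : (Y.R n x, Y.J n x - x) ∈ A.graph := by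
  rw [Y.mem_graph_iff n, J_apply, sub_sub_cancel]

theorem J_mem_graph (n : ℕ) (x : E) : (Y.J n x, Y.B n x) ∈ A.graph := by
  rw [J_apply, B_apply, ← Complex.coe_smul, ← Complex.coe_smul, ← Prod.smul_mk]
  exact A.graph.smul_mem _ (Y.R_mem_graph n x)

theorem J_mem_domain (n : ℕ) (x : E) : Y.J n x ∈ A.domain :=
  LinearPMap.mem_domain_of_mem_graph (Y.J_mem_graph n x)

theorem J_sub_of_mem_graph (n : ℕ) {x y : E} (h : (x, y) ∈ A.graph) :
    Y.J n x - x = Y.R n y := by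
  have hR := (Y.mem_graph_iff n).1 h
  rw [map_sub, map_smul] at hR
  rw [J_apply, sub_eq_iff_eq_add, ← sub_eq_iff_eq_add', hR]

theorem B_apply_of_mem_graph (n : ℕ) {x y : E} (h : (x, y) ∈ A.graph) : Y.B n x = Y.J n y := by
  rw [B_apply, Y.J_sub_of_mem_graph n h, J_apply]

theorem tendsto_inv_lam : Tendsto (fun n => (Y.lam n)⁻¹) atTop (𝓝 0) :=
  tendsto_inv_atTop_zero.comp Y.tendsto_lam

theorem tendsto_R_apply (x : E) : Tendsto (fun n => Y.R n x) atTop (𝓝 0) := by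
  have hbound : ∀ n, ‖Y.R n x‖ ≤ (Y.lam n)⁻¹ * (M * ‖x‖) := fun n => by
    rw [inv_mul_eq_div, le_div_iff₀' (Y.lam_pos n), ← Real.norm_of_nonneg (Y.lam_pos n).le,
      ← norm_smul]
    exact Y.norm_J_apply_le n x
  refine squeeze_zero_norm hbound ?_
  simpa only [zero_mul] using Y.tendsto_inv_lam.mul_const (M * ‖x‖)

theorem resolvent_identity (m n : ℕ) (x : E) :
    Y.R n x - Y.R m x = (Y.lam m - Y.lam n) • Y.R m (Y.R n x) := by
  have h := (Y.mem_graph_iff m).1 (Y.R_mem_graph n x)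
  have hsplit : Y.lam m • Y.R n x - (Y.J n x - x) = x + (Y.lam m - Y.lam n) • Y.R n x := by
    rw [J_apply, sub_smul]; abel
  rw [hsplit, map_add, map_smul] at h
  rw [sub_eq_iff_eq_add', h]

theorem commute_R (m n : ℕ) : Commute (Y.R m) (Y.R n) := by
  ext x
  change Y.R m (Y.R n x) = Y.R n (Y.R m x)
  rcases eq_or_ne (Y.lam m) (Y.lam n) with heq | hne
  · have hR : ∀ y, Y.R n y = Y.R m y := fun y => by
      simpa only [heq, sub_self, zero_smul, sub_eq_zero] using Y.resolvent_identity m n y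
    rw [hR, hR]
  · refine smul_right_injective E (sub_ne_zero.2 hne) ?_
    change (Y.lam m - Y.lam n) • _ = (Y.lam m - Y.lam n) • _
    rw [← Y.resolvent_identity m n, ← neg_sub, Y.resolvent_identity n m, ← neg_smul, neg_sub]

theorem commute_R_J (m n : ℕ) : Commute (Y.R m) (Y.J n) := (Y.commute_R m n).smul_right _

theorem commute_R_B (m n : ℕ) : Commute (Y.R m) (Y.B n) :=
  ((Y.commute_R_J m n).sub_right (Commute.one_right _)).smul_right _

theorem commute_J_B (m n : ℕ) : Commute (Y.J m) (Y.B n) := (Y.commute_R_B m n).smul_left _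

theorem commute_B (m n : ℕ) : Commute (Y.B m) (Y.B n) :=
  ((Y.commute_J_B m n).sub_left (Commute.one_left _)).smul_left _

theorem equicontinuous_J : Equicontinuous fun n => ⇑(Y.J n) :=
  (LipschitzWith.uniformEquicontinuous _ M fun n =>
    ContinuousLinearMap.lipschitzWith_of_opNorm_le (Y.norm_smul_R_le n)).equicontinuous

theorem tendsto_J_apply {x : E} (hx : x ∈ closure (A.domain : Set E)) :
    Tendsto (fun n => Y.J n x) atTop (𝓝 x) := by
  refine closure_minimal (fun y hy => ?_)
    (Y.equicontinuous_J.isClosed_setOfPred_tendsto continuous_id) hx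
  obtain ⟨z, hz⟩ := LinearPMap.mem_domain_iff.1 hy
  change Tendsto (fun n => Y.J n y) atTop (𝓝 y)
  simpa only [← Y.J_sub_of_mem_graph _ hz, sub_add_cancel, zero_add] using
    (Y.tendsto_R_apply z).add_const y

end YosidaSystem

/-! ### Convergence of the approximating semigroups -/

theorem isClosed_setOf_cauchySeq {X Z : Type*} [PseudoEMetricSpace X] [PseudoMetricSpace Z]
    {K : ℝ≥0} {L : ℕ → X → Z} (hL : ∀ n, LipschitzWith K (L n)) :
    IsClosed {x | CauchySeq fun n => L n x} := by
  have hdist : ∀ n : ℕ × ℕ, LipschitzWith (2 * K) fun x => dist (L n.1 x) (L n.2 x) := fun n => by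
    have h := LipschitzWith.dist.comp ((hL n.1).prodMk (hL n.2))
    rwa [max_self] at h
  simp only [cauchySeq_iff_tendsto_dist_atTop_0]
  exact (LipschitzWith.uniformEquicontinuous _ _ hdist).equicontinuous.isClosed_setOfPred_tendsto
    continuous_const

theorem cauchySeq_of_dist_le_mul {X Z : Type*} [PseudoMetricSpace X] [PseudoMetricSpace Z]
    {a : ℕ → X} {b : ℕ → Z} (c : ℝ) (hab : ∀ m n, dist (a m) (a n) ≤ c * dist (b m) (b n))
    (hb : CauchySeq b) : CauchySeq a := by
  rw [cauchySeq_iff_tendsto_dist_atTop_0] at hb ⊢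
  exact squeeze_zero (fun _ => dist_nonneg) (fun n => hab n.1 n.2)
    (by simpa only [mul_zero] using hb.const_mul c)

namespace YosidaSystem

variable {T : ℝ} {M : ℝ≥0} (Y : YosidaSystem A T M)

theorem S_zero (n : ℕ) : Y.S n 0 = 1 := by rw [S, zero_smul, NormedSpace.exp_zero]

variable [CompleteSpace E]

theorem hasDerivAt_S_apply (n : ℕ) (x : E) (t : ℝ) :
    HasDerivAt (fun r => Y.S n r x) (Y.S n t (Y.B n x)) t := by
  have h := (hasDerivAt_exp_smul_const (Y.B n) t).clm_apply (hasDerivAt_const t x)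
  rwa [map_zero, add_zero] at h

/-- Duhamel's formula for the difference of two semigroups: differentiate
`r ↦ S_m(t - r) S_n(r) x`. -/
theorem norm_S_apply_sub_le (m n : ℕ) {t : ℝ} (ht : t ∈ Icc 0 T) (x : E) :
    ‖Y.S n t x - Y.S m t x‖ ≤ M * (M * ‖Y.B n x - Y.B m x‖) * t := by
  set φ : ℝ → E := fun r => Y.S m (t - r) (Y.S n r x)
  have hφ : ∀ r, HasDerivAt φ (Y.S m (t - r) (Y.S n r (Y.B n x - Y.B m x))) r := fun r => by
    have hm : HasDerivAt (fun r => Y.S m (t - r)) (-(Y.S m (t - r) * Y.B m)) r :=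
      (hasDerivAt_exp_smul_const (Y.B m) (t - r)).comp_const_sub t r
    have hcomm : Y.B m (Y.S n r x) = Y.S n r (Y.B m x) :=
      exp_smul_apply_comm (Y.commute_B m n) r x
    refine (hm.clm_apply (Y.hasDerivAt_S_apply n x r)).congr_deriv ?_
    rw [neg_apply, mul_apply_eq_comp, hcomm, map_sub, map_sub]
    abel
  have hbound : ∀ r ∈ Ico 0 t,
      ‖Y.S m (t - r) (Y.S n r (Y.B n x - Y.B m x))‖ ≤ M * (M * ‖Y.B n x - Y.B m x‖) :=
    fun r hr => (Y.norm_S_apply_le m ⟨by linarith [hr.2], by linarith [hr.1, ht.2]⟩ _).trans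
      (mul_le_mul_of_nonneg_left (Y.norm_S_apply_le n ⟨hr.1, by linarith [hr.2, ht.2]⟩ _) M.2)
  simpa [φ, S_zero] using norm_image_sub_le_of_norm_deriv_le_segment'
    (fun r _ => (hφ r).hasDerivWithinAt) hbound t ⟨ht.1, le_rfl⟩

theorem cauchySeq_S_of_cauchySeq_B {t : ℝ} (ht : t ∈ Icc 0 T) {x : E}
    (hx : CauchySeq fun n => Y.B n x) : CauchySeq fun n => Y.S n t x := by
  refine cauchySeq_of_dist_le_mul (M * M * t) (fun m n => ?_) hx
  rw [dist_eq_norm, dist_eq_norm]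
  exact (Y.norm_S_apply_sub_le n m ht x).trans_eq (by ring)

theorem cauchySeq_S {t : ℝ} (ht : t ∈ Icc 0 T) {x : E} (hx : x ∈ closure (A.domain : Set E)) :
    CauchySeq fun n => Y.S n t x := by
  have hclosed : IsClosed {x | CauchySeq fun n => Y.S n t x} := isClosed_setOf_cauchySeq
    fun n => ContinuousLinearMap.lipschitzWith_of_opNorm_le (Y.norm_S_le n ht)
  refine closure_minimal (fun y hy => ?_) hclosed hx
  obtain ⟨z, hz⟩ := LinearPMap.mem_domain_iff.1 hy
  refine hclosed.mem_of_tendsto (Y.tendsto_J_apply (subset_closure hy)) (.of_forall fun m => ?_)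
  refine Y.cauchySeq_S_of_cauchySeq_B ht ?_
  simp only [Y.B_apply_of_mem_graph _ (Y.J_mem_graph m y), Y.B_apply_of_mem_graph m hz]
  exact (Y.tendsto_J_apply (subset_closure (Y.J_mem_domain m z))).cauchySeq

end YosidaSystem

/-! ### Convergence of the approximating mild solutions -/

theorem cauchySeq_of_forall_exists_dist_le {X : Type*} [PseudoMetricSpace X] {a : ℕ → X}
    (h : ∀ ε > 0, ∃ b : ℕ → X, CauchySeq b ∧ ∀ n, dist (a n) (b n) ≤ ε) : CauchySeq a := by
  refine Metric.cauchySeq_iff'.2 fun ε hε => ?_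
  obtain ⟨b, hb, hab⟩ := h (ε / 4) (by positivity)
  obtain ⟨N, hN⟩ := Metric.cauchySeq_iff'.1 hb (ε / 4) (by positivity)
  refine ⟨N, fun n hn => ?_⟩
  have htriangle := dist_triangle4 (a n) (b n) (b N) (a N)
  have habN := hab N
  rw [dist_comm] at habN
  linarith [hab n, hN n hn]

theorem exists_contDiff_integral_norm_sub_le {F : Type*} [NormedAddCommGroup F] [NormedSpace ℝ F]
    {g : ℝ → F} {a b : ℝ} (hab : a ≤ b) (hg : IntervalIntegrable g volume a b) {ε : ℝ}
    (hε : 0 < ε) : ∃ k : ℝ → F, ContDiff ℝ 1 k ∧ ∫ s in a..b, ‖g s - k s‖ ≤ ε := by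
  have hgL : MemLp g 1 (volume.restrict (Ioc a b)) :=
    memLp_one_iff_integrable.2 ((intervalIntegrable_iff_integrableOn_Ioc_of_le hab).1 hg)
  obtain ⟨k, -, hk, hle⟩ := hgL.exist_eLpNorm_sub_le ENNReal.one_ne_top le_rfl hε
  refine ⟨k, hk.of_le (by exact_mod_cast le_top), ?_⟩
  have hgk : IntegrableOn (g - k) (Ioc a b) :=
    (intervalIntegrable_iff_integrableOn_Ioc_of_le hab).1
      (hg.sub (hk.continuous.intervalIntegrable a b))
  rw [eLpNorm_one_eq_lintegral_enorm, ← ofReal_integral_norm_eq_lintegral_enorm hgk,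
    ENNReal.ofReal_le_ofReal_iff hε.le] at hle
  rwa [intervalIntegral.integral_of_le hab]

namespace YosidaSystem

variable {T : ℝ} {M : ℝ≥0} (Y : YosidaSystem A T M)

theorem inv_lam_smul_B_apply (n : ℕ) (x : E) : (Y.lam n)⁻¹ • Y.B n x = Y.J n x - x := by
  rw [B_apply, inv_smul_smul₀ (Y.lam_pos n).ne']

/-- The last term is small for large `n`, so `x` is controlled by `λ_m R(λ_m : A) x` and
`R(λ_m : A) B_n x`, both of which lie in `D(A)`. -/
theorem J_apply_sub (m n : ℕ) (x : E) : Y.J m x - x =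
    Y.R m (Y.B n x) - (Y.lam n)⁻¹ • (Y.J m (Y.B n x) - Y.B n x) := by
  have hR : Y.R m (Y.B n x) = Y.J n (Y.J m x - x) := by
    rw [← Y.B_apply_of_mem_graph n (Y.R_mem_graph m x)]
    exact DFunLike.congr_fun (Y.commute_R_B m n).eq x
  have hJ : Y.J m (Y.B n x) = Y.B n (Y.J m x) := DFunLike.congr_fun (Y.commute_J_B m n).eq x
  rw [hR, hJ, ← map_sub, inv_lam_smul_B_apply, sub_sub_cancel]

theorem tendsto_inv_lam_smul {y : ℕ → E} {c : ℝ} (hy : ∀ n, ‖y n‖ ≤ c) :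
    Tendsto (fun n => (Y.lam n)⁻¹ • y n) atTop (𝓝 0) :=
  Y.tendsto_inv_lam.zero_smul_isBoundedUnder_le
    ⟨c, eventually_map.2 (.of_forall hy)⟩

/-- The solution of the approximate problem `v' = B_n v + g`, `v(0) = x`. -/
def mild (n : ℕ) (x : E) (g : ℝ → E) (t : ℝ) : E := Y.S n t x + duhamel (Y.B n) g t

theorem norm_duhamel_B_le (n : ℕ) {g : ℝ → E} {t : ℝ} (ht : t ∈ Icc 0 T)
    (hg : IntervalIntegrable g volume 0 t) :
    ‖duhamel (Y.B n) g t‖ ≤ M * ∫ s in (0 : ℝ)..t, ‖g s‖ :=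
  norm_duhamel_le (Y.norm_exp_le n) ht hg

theorem norm_mild_le (n : ℕ) (x : E) {g : ℝ → E} {t : ℝ} (ht : t ∈ Icc 0 T)
    (hg : IntervalIntegrable g volume 0 t) :
    ‖Y.mild n x g t‖ ≤ M * (‖x‖ + ∫ s in (0 : ℝ)..t, ‖g s‖) := by
  rw [mul_add]
  exact norm_add_le_of_le (Y.norm_S_apply_le n ht x) (Y.norm_duhamel_B_le n ht hg)

theorem norm_mild_le_integral (n : ℕ) (x : E) {g : ℝ → E} {t : ℝ} (ht : t ∈ Icc 0 T)
    (hg : IntervalIntegrable g volume 0 T) :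
    ‖Y.mild n x g t‖ ≤ M * (‖x‖ + ∫ s in (0 : ℝ)..T, ‖g s‖) :=
  (Y.norm_mild_le n x ht (intervalIntegrable_of_mem_Icc ht hg)).trans
    (mul_le_mul_of_nonneg_left (add_le_add_right (intervalIntegral.integral_mono_interval le_rfl
      ht.1 ht.2 (.of_forall fun _ => norm_nonneg _) hg.norm) _) M.2)

variable [CompleteSpace E]

theorem cauchySeq_duhamel_of_mem_closure {g : ℝ → E} {t : ℝ} (ht : t ∈ Icc 0 T)
    (hg : IntervalIntegrable g volume 0 t) (hmem : ∀ s, g s ∈ closure (A.domain : Set E)) :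
    CauchySeq fun n => duhamel (Y.B n) g t := by
  have hsub : ∀ s ∈ uIoc 0 t, t - s ∈ Icc 0 T := fun s hs => by
    rw [uIoc_of_le ht.1] at hs
    exact ⟨sub_nonneg.2 hs.2, by linarith [hs.1, ht.2]⟩
  have hlim : ∀ s ∈ uIoc 0 t, Tendsto (fun n => Y.S n (t - s) (g s)) atTop
      (𝓝 (limUnder atTop fun n => Y.S n (t - s) (g s))) := fun s hs =>
    CauchySeq.tendsto_limUnder (Y.cauchySeq_S (hsub s hs) (hmem s))
  exact (intervalIntegral.tendsto_integral_filter_of_dominated_convergence (fun s => M * ‖g s‖)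
    (.of_forall fun n => (intervalIntegrable_exp_apply hg t).def'.aestronglyMeasurable)
    (.of_forall fun n => .of_forall fun s hs => Y.norm_S_apply_le n (hsub s hs) _)
    (hg.norm.const_mul _)
    (.of_forall hlim)).cauchySeq

theorem apply_mild {L : E →L[ℝ] E} {n : ℕ} (h : Commute L (Y.B n)) (x : E) {g : ℝ → E} {t : ℝ}
    (hg : IntervalIntegrable g volume 0 t) :
    L (Y.mild n x g t) = Y.mild n (L x) (fun s => L (g s)) t := by
  rw [mild, map_add, duhamel_apply_comm h hg]
  exact congrArg (· + _) (exp_smul_apply_comm h t x)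

theorem mild_eq (n : ℕ) (x : E) {g : ℝ → E} {t : ℝ} (ht : 0 ≤ t)
    (hg : IntervalIntegrable g volume 0 t) : Y.mild n x g t =
      x + (∫ s in (0 : ℝ)..t, g s) + Y.B n (∫ s in (0 : ℝ)..t, Y.mild n x g s) :=
  exp_add_duhamel_eq ht hg

theorem cauchySeq_R_mild (m : ℕ) (x : E) {g : ℝ → E} {t : ℝ} (ht : t ∈ Icc 0 T)
    (hg : IntervalIntegrable g volume 0 t) : CauchySeq fun n => Y.R m (Y.mild n x g t) := by
  have hR : ∀ y, Y.R m y ∈ closure (A.domain : Set E) := fun y =>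
    subset_closure (LinearPMap.mem_domain_of_mem_graph (Y.R_mem_graph m y))
  simp only [Y.apply_mild (Y.commute_R_B m _) x hg]
  exact (Y.cauchySeq_S ht (hR x)).add (Y.cauchySeq_duhamel_of_mem_closure ht
    (intervalIntegrable_clm_apply continuous_const hg) fun s => hR (g s))

theorem B_apply_duhamel {k : ℝ → E} (hk : ContDiff ℝ 1 k) (n : ℕ) {t : ℝ} (ht : 0 ≤ t) :
    Y.B n (duhamel (Y.B n) k t) = Y.mild n (k 0) (deriv k) t - k t := by
  have hk' : Continuous (deriv k) := hk.continuous_deriv le_rfl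
  have hki : IntervalIntegrable k volume 0 t := hk.continuous.intervalIntegrable 0 t
  have hFTC : ∀ s, k 0 + ∫ r in (0 : ℝ)..s, deriv k r = k s := fun s => by
    rw [intervalIntegral.integral_deriv_eq_sub
      (fun r _ => (hk.differentiable one_ne_zero).differentiableAt) (hk'.intervalIntegrable 0 s),
      add_sub_cancel]
  have h := eq_exp_add_duhamel (B := Y.B n) (w₀ := k 0) ht (hk'.intervalIntegrable 0 t)
  simp only [hFTC] at h
  rw [duhamel_sub (hk'.intervalIntegrable 0 t)
    (intervalIntegrable_clm_apply continuous_const hki),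
    ← duhamel_apply_comm (Commute.refl _) hki] at h
  rw [eq_sub_iff_add_eq', h, mild, S]
  abel

theorem cauchySeq_duhamel_of_contDiff {k : ℝ → E} (hk : ContDiff ℝ 1 k) {t : ℝ}
    (ht : t ∈ Icc 0 T) : CauchySeq fun n => duhamel (Y.B n) k t := by
  have hki : IntervalIntegrable k volume 0 t := hk.continuous.intervalIntegrable 0 t
  have hki' : IntervalIntegrable (deriv k) volume 0 t :=
    (hk.continuous_deriv le_rfl).intervalIntegrable 0 t
  set b : ℕ → E := fun n => Y.mild n (k 0) (deriv k) t - k t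
  have hrep : ∀ n, duhamel (Y.B n) k t = Y.lam 0 • Y.R 0 (Y.mild n 0 k t) - Y.R 0 (b n) +
      (Y.lam n)⁻¹ • (Y.J 0 (b n) - b n) := fun n => by
    have h := Y.J_apply_sub 0 n (duhamel (Y.B n) k t)
    rw [Y.B_apply_duhamel hk n ht.1, J_apply] at h
    rw [mild, map_zero, zero_add, sub_add, ← h, sub_sub_cancel]
  have hJ : CauchySeq fun n => Y.lam 0 • Y.R 0 (Y.mild n 0 k t) :=
    (uniformContinuous_const_smul _).comp_cauchySeq (Y.cauchySeq_R_mild 0 0 ht hki)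
  have hR : CauchySeq fun n => Y.R 0 (b n) := by
    simp only [b, map_sub]
    exact uniformContinuous_sub.comp_cauchySeq
      ((Y.cauchySeq_R_mild 0 (k 0) ht hki').prodMk (cauchySeq_const (Y.R 0 (k t))))
  have hb : ∀ n, ‖b n‖ ≤ M * (‖k 0‖ + ∫ s in (0 : ℝ)..t, ‖deriv k s‖) + ‖k t‖ := fun n =>
    norm_sub_le_of_le (Y.norm_mild_le n (k 0) ht hki') le_rfl
  have hsmall := Y.tendsto_inv_lam_smul fun n => norm_sub_le_of_le
    ((Y.norm_J_apply_le 0 (b n)).trans (mul_le_mul_of_nonneg_left (hb n) M.2)) (hb n)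
  rw [funext hrep]
  exact (uniformContinuous_sub.comp_cauchySeq (hJ.prodMk hR)).add hsmall.cauchySeq

theorem cauchySeq_duhamel {g : ℝ → E} {t : ℝ} (ht : t ∈ Icc 0 T)
    (hg : IntervalIntegrable g volume 0 t) : CauchySeq fun n => duhamel (Y.B n) g t := by
  refine cauchySeq_of_forall_exists_dist_le fun ε hε => ?_
  obtain ⟨k, hk, hle⟩ := exists_contDiff_integral_norm_sub_le ht.1 hg
    (ε := ε / (M + 1)) (by positivity)
  refine ⟨_, Y.cauchySeq_duhamel_of_contDiff hk ht, fun n => ?_⟩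
  have hki := hk.continuous.intervalIntegrable (μ := volume) 0 t
  rw [dist_eq_norm, ← duhamel_sub hg hki]
  calc ‖duhamel (Y.B n) (fun s => g s - k s) t‖ ≤ M * ∫ s in (0 : ℝ)..t, ‖g s - k s‖ :=
        Y.norm_duhamel_B_le n ht (hg.sub hki)
    _ ≤ M * (ε / (M + 1)) := by gcongr
    _ ≤ (M + 1) * (ε / (M + 1)) := by gcongr; exact le_add_of_nonneg_right zero_le_one
    _ = ε := mul_div_cancel₀ ε (by positivity)

/-- The mild solution of `v' = A v + g`, `v(0) = x`, as the limit of those of the approximate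
problems. -/
def mildLimit (x : E) (g : ℝ → E) (t : ℝ) : E := limUnder atTop fun n => Y.mild n x g t

section MildLimit

variable {x : E} {g : ℝ → E}

theorem tendsto_mild (hx : x ∈ closure (A.domain : Set E)) {t : ℝ} (ht : t ∈ Icc 0 T)
    (hg : IntervalIntegrable g volume 0 T) :
    Tendsto (fun n => Y.mild n x g t) atTop (𝓝 (Y.mildLimit x g t)) :=
  CauchySeq.tendsto_limUnder ((Y.cauchySeq_S ht hx).add
    (Y.cauchySeq_duhamel ht (intervalIntegrable_of_mem_Icc ht hg)))

theorem norm_mildLimit_le (hx : x ∈ closure (A.domain : Set E)) {t : ℝ} (ht : t ∈ Icc 0 T)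
    (hg : IntervalIntegrable g volume 0 T) :
    ‖Y.mildLimit x g t‖ ≤ M * (‖x‖ + ∫ s in (0 : ℝ)..T, ‖g s‖) :=
  le_of_tendsto (Y.tendsto_mild hx ht hg).norm
    (.of_forall fun n => Y.norm_mild_le_integral n x ht hg)

theorem continuousOn_mild (n : ℕ) (hT : 0 ≤ T) (hg : IntervalIntegrable g volume 0 T) :
    ContinuousOn (Y.mild n x g) (Icc 0 T) :=
  continuousOn_exp_add_duhamel hT hg x

theorem aestronglyMeasurable_mildLimit (hT : 0 ≤ T) (hx : x ∈ closure (A.domain : Set E))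
    (hg : IntervalIntegrable g volume 0 T) :
    AEStronglyMeasurable (Y.mildLimit x g) (volume.restrict (Icc 0 T)) :=
  aestronglyMeasurable_of_tendsto_ae atTop
    (fun n => (Y.continuousOn_mild n hT hg).aestronglyMeasurable measurableSet_Icc)
    ((ae_restrict_iff' measurableSet_Icc).2 (.of_forall fun _ ht => Y.tendsto_mild hx ht hg))

theorem tendsto_integral_mild (hx : x ∈ closure (A.domain : Set E)) {t : ℝ} (ht : t ∈ Icc 0 T)
    (hg : IntervalIntegrable g volume 0 T) :
    Tendsto (fun n => ∫ s in (0 : ℝ)..t, Y.mild n x g s) atTop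
      (𝓝 (∫ s in (0 : ℝ)..t, Y.mildLimit x g s)) := by
  have hsub : uIoc 0 t ⊆ Icc 0 T := by
    rw [uIoc_of_le ht.1]
    exact Ioc_subset_Icc_self.trans (Icc_subset_Icc_right ht.2)
  exact intervalIntegral.tendsto_integral_filter_of_dominated_convergence
    (fun _ => M * (‖x‖ + ∫ s in (0 : ℝ)..T, ‖g s‖))
    (.of_forall fun n => ((Y.continuousOn_mild n (ht.1.trans ht.2) hg).mono
      hsub).aestronglyMeasurable measurableSet_uIoc)
    (.of_forall fun n => .of_forall fun s hs => Y.norm_mild_le_integral n x (hsub hs) hg)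
    intervalIntegrable_const (.of_forall fun s hs => Y.tendsto_mild hx (hsub hs) hg)

/-- The mild solution `v` of `v' = A v + g`, `v(0) = a₀ + f₀`, is the derivative of the strict
solution `u₀ + ∫ v` of `u' = A u + f₀ + ∫ g`, `u(0) = u₀`. -/
theorem primitive_mildLimit_mem_graph (hA : A.IsClosed) {f₀ u₀ a₀ : E}
    (hu : (u₀, a₀) ∈ A.graph) (hcl : a₀ + f₀ ∈ closure (A.domain : Set E)) {t : ℝ}
    (ht : t ∈ Icc 0 T) (hg : IntervalIntegrable g volume 0 T) :
    (u₀ + ∫ s in (0 : ℝ)..t, Y.mildLimit (a₀ + f₀) g s,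
      Y.mildLimit (a₀ + f₀) g t - (f₀ + ∫ s in (0 : ℝ)..t, g s)) ∈ A.graph := by
  set v := Y.mildLimit (a₀ + f₀) g
  -- `u₀ - λ_n⁻¹ a₀ = (1 - λ_n⁻¹ A) u₀` is chosen so that `B_n` maps it to `a₀`.
  set u : ℕ → E := fun n =>
    u₀ - (Y.lam n)⁻¹ • a₀ + ∫ s in (0 : ℝ)..t, Y.mild n (a₀ + f₀) g s
  have hBu : ∀ n, Y.B n (u n) = Y.mild n (a₀ + f₀) g t - (f₀ + ∫ s in (0 : ℝ)..t, g s) :=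
    fun n => by
      have hinit : Y.B n (u₀ - (Y.lam n)⁻¹ • a₀) = a₀ := by
        rw [map_sub, map_smul, inv_lam_smul_B_apply, Y.B_apply_of_mem_graph n hu, sub_sub_cancel]
      rw [map_add, hinit, Y.mild_eq n _ ht.1 (intervalIntegrable_of_mem_Icc ht hg)]
      abel
  have hu_lim : Tendsto u atTop (𝓝 (u₀ + ∫ s in (0 : ℝ)..t, v s)) := by
    have h := (Y.tendsto_inv_lam.smul_const a₀).const_sub u₀
    rw [zero_smul, sub_zero] at h
    exact h.add (Y.tendsto_integral_mild hcl ht hg)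
  have hBu_lim : Tendsto (fun n => Y.B n (u n)) atTop
      (𝓝 (v t - (f₀ + ∫ s in (0 : ℝ)..t, g s))) := by
    simpa only [hBu] using (Y.tendsto_mild hcl ht hg).sub_const _
  have hJu_lim : Tendsto (fun n => Y.J n (u n)) atTop (𝓝 (u₀ + ∫ s in (0 : ℝ)..t, v s)) := by
    simpa only [inv_lam_smul_B_apply, add_sub_cancel, zero_smul, add_zero] using
      hu_lim.add (Y.tendsto_inv_lam.smul hBu_lim)
  exact hA.mem_of_tendsto (hJu_lim.prodMk_nhds hBu_lim) (.of_forall fun n => Y.J_mem_graph n _)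

end MildLimit

end YosidaSystem

/-! ### The a priori estimate -/

theorem subset_closure_inter_setOf_of_ae_restrict {X : Type*} [TopologicalSpace X]
    [MeasurableSpace X] [OpensMeasurableSpace X] {μ : Measure X} [μ.IsOpenPosMeasure] {U : Set X}
    (hU : IsOpen U) {P : X → Prop} (h : ∀ᵐ x ∂μ.restrict U, P x) :
    U ⊆ closure (U ∩ {x | P x}) := by
  have hdense : Dense {x | x ∈ U → P x} :=
    Measure.dense_of_ae ((ae_restrict_iff' hU.measurableSet).1 h)
  exact (hdense.open_subset_closure_inter hU).trans
    (closure_mono fun x hx => ⟨hx.1, hx.2 hx.1⟩)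

theorem ae_mem_closure_of_ae_primitive_mem {F : Type*} [NormedAddCommGroup F] [NormedSpace ℝ F]
    [CompleteSpace F] {V : Submodule ℝ F} {g : ℝ → F} {a b : ℝ} (hab : a ≤ b)
    (hg : IntervalIntegrable g volume a b) {w₀ : F}
    (h : ∀ᵐ t ∂volume.restrict (Ioo a b), w₀ + ∫ s in a..t, g s ∈ V) :
    ∀ᵐ t ∂volume.restrict (Ioo a b), g t ∈ closure (V : Set F) := by
  set w : ℝ → F := fun t => w₀ + ∫ s in a..t, g s
  have hrange := range_derivWithin_subset_closure_span_image w
    (subset_closure_inter_setOf_of_ae_restrict isOpen_Ioo h)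
  have hspan : Submodule.span ℝ (w '' {t | w t ∈ V}) ≤ V :=
    Submodule.span_le.2 (image_subset_iff.2 fun _ ht => ht)
  refine (ae_restrict_iff' measurableSet_Ioo).2 ?_
  filter_upwards [hg.ae_hasDerivAt_integral] with t hderiv ht
  have hmem : t ∈ uIcc a b := by rw [uIcc_of_le hab]; exact Ioo_subset_Icc_self ht
  have hw : derivWithin w (Ioo a b) t = g t :=
    ((hderiv hmem a left_mem_uIcc).const_add w₀).hasDerivWithinAt.derivWithin
      (isOpen_Ioo.uniqueDiffWithinAt ht)
  exact closure_mono hspan (hrange ⟨t, hw⟩)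

theorem duhamel_congr_ae {F : Type*} [NormedAddCommGroup F] [NormedSpace ℝ F] (B : F →L[ℝ] F)
    {g k : ℝ → F} {t : ℝ} (ht : 0 ≤ t) (h : g =ᵐ[volume.restrict (Ioo 0 t)] k) :
    duhamel B g t = duhamel B k t := by
  rw [duhamel, duhamel, intervalIntegral.integral_of_le ht, intervalIntegral.integral_of_le ht,
    ← restrict_Ioo_eq_restrict_Ioc]
  exact integral_congr_ae (h.mono fun s hs => by simp only [hs])

namespace YosidaSystem

variable {T : ℝ} {M : ℝ≥0} (Y : YosidaSystem A T M) {w₀ : E} {g f : ℝ → E} {t : ℝ}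

theorem tendsto_integral_norm_sub_J (hf : IntervalIntegrable f volume 0 t) (ht : 0 ≤ t)
    (hmem : ∀ᵐ s ∂volume.restrict (Ioo 0 t), f s ∈ closure (A.domain : Set E)) :
    Tendsto (fun n => ∫ s in (0 : ℝ)..t, ‖f s - Y.J n (f s)‖) atTop (𝓝 0) := by
  rw [restrict_Ioo_eq_restrict_Ioc, ← uIoc_of_le ht,
    ae_restrict_iff' measurableSet_uIoc] at hmem
  suffices h : Tendsto (fun n => ∫ s in (0 : ℝ)..t, ‖f s - Y.J n (f s)‖) atTop
      (𝓝 (∫ _ in (0 : ℝ)..t, (0 : ℝ))) by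
    simpa only [intervalIntegral.integral_zero] using h
  refine intervalIntegral.tendsto_integral_filter_of_dominated_convergence
    (fun s => ‖f s‖ + M * ‖f s‖)
    (.of_forall fun n =>
      (hf.sub (intervalIntegrable_clm_apply continuous_const hf)).norm.def'.aestronglyMeasurable)
    (.of_forall fun n => .of_forall fun s _ => ?_) (hf.norm.add (hf.norm.const_mul _)) ?_
  · rw [norm_norm]
    exact norm_sub_le_of_le le_rfl (Y.norm_J_apply_le n (f s))
  · filter_upwards [hmem] with s hs hst
    simpa only [sub_self, norm_zero] using ((Y.tendsto_J_apply (hs hst)).const_sub (f s)).norm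

variable [CompleteSpace E]

theorem primitive_eq_mild (n : ℕ) (ht : 0 ≤ t) (hg : IntervalIntegrable g volume 0 t)
    (h : ∀ᵐ s ∂volume.restrict (Ioo 0 t), (w₀ + ∫ r in (0 : ℝ)..s, g r, g s - f s) ∈ A.graph) :
    w₀ + ∫ s in (0 : ℝ)..t, g s =
      Y.mild n w₀ (fun s => Y.J n (f s) + (g s - Y.J n (g s))) t := by
  rw [eq_exp_add_duhamel (B := Y.B n) ht hg, mild, S]
  refine congrArg _ (duhamel_congr_ae _ ht ?_)
  filter_upwards [h] with s hs
  rw [Y.B_apply_of_mem_graph n hs, map_sub]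
  abel

include Y in
theorem norm_primitive_le_of_ae_mem_graph (ht : t ∈ Icc 0 T)
    (hg : IntervalIntegrable g volume 0 t) (hf : IntervalIntegrable f volume 0 t)
    (h : ∀ᵐ s ∂volume.restrict (Ioo 0 t), (w₀ + ∫ r in (0 : ℝ)..s, g r, g s - f s) ∈ A.graph) :
    ‖w₀ + ∫ s in (0 : ℝ)..t, g s‖ ≤ M * (‖w₀‖ + M * ∫ s in (0 : ℝ)..t, ‖f s‖) := by
  have hJ : ∀ (n : ℕ) {k : ℝ → E}, IntervalIntegrable k volume 0 t →
      IntervalIntegrable (fun s => Y.J n (k s)) volume 0 t := fun n _ hk =>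
    intervalIntegrable_clm_apply continuous_const hk
  have hgmem : ∀ᵐ s ∂volume.restrict (Ioo 0 t), g s ∈ closure (A.domain : Set E) :=
    ae_mem_closure_of_ae_primitive_mem (V := A.domain.restrictScalars ℝ) ht.1 hg
      (h.mono fun s hs => LinearPMap.mem_domain_of_mem_graph hs)
  have hbound : ∀ n, ‖w₀ + ∫ s in (0 : ℝ)..t, g s‖ ≤ M * (‖w₀‖ +
      (M * (∫ s in (0 : ℝ)..t, ‖f s‖) + ∫ s in (0 : ℝ)..t, ‖g s - Y.J n (g s)‖)) := fun n => by
    rw [Y.primitive_eq_mild n ht.1 hg h, ← intervalIntegral.integral_const_mul,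
      ← intervalIntegral.integral_add (hf.norm.const_mul _) (hg.sub (hJ n hg)).norm]
    have hsum := (hJ n hf).add (hg.sub (hJ n hg))
    refine (Y.norm_mild_le n w₀ ht hsum).trans ?_
    gcongr
    exact intervalIntegral.integral_mono_on ht.1 hsum.norm
      ((hf.norm.const_mul _).add (hg.sub (hJ n hg)).norm)
      fun s _ => norm_add_le_of_le (Y.norm_J_apply_le n (f s)) le_rfl
  have hlim := (((Y.tendsto_integral_norm_sub_J hg ht.1 hgmem).const_add
    (M * ∫ s in (0 : ℝ)..t, ‖f s‖)).const_add ‖w₀‖).const_mul (M : ℝ)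
  rw [add_zero] at hlim
  exact ge_of_tendsto' hlim hbound

end YosidaSystem

end Resolvent

/-! ### The spaces `L^p(0, T; E)` and `W^{1,p}(0, T; E)` -/

theorem exists_integral_norm_le {X E : Type*} [MeasurableSpace X] [NormedAddCommGroup E]
    (μ : Measure X) [IsFiniteMeasure μ] (p : ℝ≥0∞) [hp : Fact (1 ≤ p)] :
    ∃ K : ℝ≥0, ∀ g : Lp E p μ, ∫ x, ‖g x‖ ∂μ ≤ K * ‖g‖ := by
  have hexp : 0 ≤ 1 / (1 : ℝ≥0∞).toReal - 1 / p.toReal := by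
    rw [sub_nonneg, one_div, one_div, ← ENNReal.toReal_inv, ← ENNReal.toReal_inv]
    exact ENNReal.toReal_mono (by simp) (ENNReal.inv_le_inv.2 hp.out)
  set c := μ univ ^ (1 / (1 : ℝ≥0∞).toReal - 1 / p.toReal)
  have hc : c ≠ ∞ := ENNReal.rpow_ne_top_of_nonneg hexp (measure_ne_top μ univ)
  refine ⟨c.toNNReal, fun g => ?_⟩
  have hle : eLpNorm g 1 μ ≤ c * eLpNorm g p μ := by
    rw [mul_comm]
    exact eLpNorm_le_eLpNorm_mul_rpow_measure_univ hp.out (Lp.aestronglyMeasurable g)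
  rw [integral_norm_eq_lintegral_enorm (Lp.aestronglyMeasurable g),
    ← eLpNorm_one_eq_lintegral_enorm, Lp.norm_def, ENNReal.coe_toNNReal_eq_toReal,
    ← ENNReal.toReal_mul]
  exact ENNReal.toReal_mono (ENNReal.mul_ne_top hc (Lp.eLpNorm_ne_top g)) hle

section LpSpaces

variable {E : Type*} [NormedAddCommGroup E] {p : ℝ≥0∞} {T : ℝ}

instance isFiniteMeasure_intervalMeasure (T : ℝ) : IsFiniteMeasure (intervalMeasure T) :=
  inferInstanceAs (IsFiniteMeasure (volume.restrict (Ioo 0 T)))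

theorem neZero_intervalMeasure (hT : 0 < T) : NeZero (intervalMeasure T) := by
  refine ⟨fun h => ?_⟩
  have huniv := congrArg (fun μ => μ univ) h
  simp only [intervalMeasure, Measure.restrict_apply_univ, Real.volume_Ioo, sub_zero,
    Measure.coe_zero, Pi.zero_apply, ENNReal.ofReal_eq_zero] at huniv
  exact hT.not_ge huniv

theorem ae_intervalMeasure_of_forall_mem_Icc {P : ℝ → Prop} (h : ∀ t ∈ Icc 0 T, P t) :
    ∀ᵐ t ∂intervalMeasure T, P t :=
  (ae_restrict_iff' measurableSet_Ioo).2 (.of_forall fun t ht => h t (Ioo_subset_Icc_self ht))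

theorem memLp_of_continuousOn_Icc {g : ℝ → E} (hg : ContinuousOn g (Icc 0 T)) :
    MemLp g p (intervalMeasure T) := by
  obtain ⟨c, hc⟩ := isCompact_Icc.exists_bound_of_continuousOn hg
  exact MemLp.of_bound ((hg.mono Ioo_subset_Icc_self).aestronglyMeasurable measurableSet_Ioo) c
    (ae_intervalMeasure_of_forall_mem_Icc hc)

section Integral

variable [NormedSpace ℝ E]

theorem integral_congr_of_ae_eq {g k : ℝ → E} (h : g =ᵐ[intervalMeasure T] k) {t : ℝ}
    (ht : t ∈ Icc 0 T) : ∫ s in (0 : ℝ)..t, g s = ∫ s in (0 : ℝ)..t, k s := by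
  rw [intervalIntegral.integral_of_le ht.1, intervalIntegral.integral_of_le ht.1,
    integral_Ioc_eq_integral_Ioo, integral_Ioc_eq_integral_Ioo]
  exact integral_congr_ae (ae_mono (Measure.restrict_mono (Ioo_subset_Ioo_right ht.2) le_rfl) h)

end Integral

namespace W1p

variable [NormedSpace ℂ E]

instance : Zero (W1p E p T) := ⟨⟨0, 0⟩⟩

instance : Sub (W1p E p T) := ⟨fun w z => ⟨w.init - z.init, w.der - z.der⟩⟩

theorem apply_zero (w : W1p E p T) : w 0 = w.init := by
  rw [toFun, intervalIntegral.integral_same, add_zero]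

theorem mk_toLp_apply (x : E) {g : ℝ → E} (hg : MemLp g p (intervalMeasure T)) {t : ℝ}
    (ht : t ∈ Icc 0 T) : (⟨x, hg.toLp g⟩ : W1p E p T) t = x + ∫ s in (0 : ℝ)..t, g s :=
  congrArg _ (integral_congr_of_ae_eq hg.coeFn_toLp ht)

theorem zero_apply {t : ℝ} (ht : t ∈ Icc 0 T) : (0 : W1p E p T) t = 0 := by
  change (0 : E) + ∫ s in (0 : ℝ)..t, (0 : LpI E p T) s = 0
  rw [integral_congr_of_ae_eq (Lp.coeFn_zero E p (intervalMeasure T)) ht, zero_add]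
  exact intervalIntegral.integral_zero

theorem exists_apply_eq_of_contDiff {k : ℝ → E} [CompleteSpace E] (hk : ContDiff ℝ 1 k) :
    ∃ w : W1p E p T, ∀ t ∈ Icc 0 T, w t = k t := by
  have hder : Continuous (deriv k) := hk.continuous_deriv le_rfl
  refine ⟨⟨k 0, (memLp_of_continuousOn_Icc hder.continuousOn).toLp _⟩, fun t ht => ?_⟩
  rw [mk_toLp_apply _ _ ht, intervalIntegral.integral_deriv_eq_sub
    (fun r _ => (hk.differentiable one_ne_zero).differentiableAt) (hder.intervalIntegrable 0 t),
    add_sub_cancel]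

end W1p

variable [Fact (1 ≤ p)]

theorem intervalIntegrable_coeFn (g : LpI E p T) {t : ℝ} (ht : t ∈ Icc 0 T) :
    IntervalIntegrable g volume 0 t :=
  (intervalIntegrable_iff_integrableOn_Ioo_of_le ht.1).2
    (((Lp.memLp g).integrable Fact.out).mono_measure
      (Measure.restrict_mono (Ioo_subset_Ioo_right ht.2) le_rfl))

theorem exists_intervalIntegral_norm_le (E : Type*) [NormedAddCommGroup E] (p : ℝ≥0∞)
    [Fact (1 ≤ p)] (T : ℝ) :
    ∃ K : ℝ≥0, ∀ g : LpI E p T, ∀ t ∈ Icc 0 T, ∫ s in (0 : ℝ)..t, ‖g s‖ ≤ K * ‖g‖ := by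
  obtain ⟨K, hK⟩ := exists_integral_norm_le (E := E) (intervalMeasure T) p
  refine ⟨K, fun g t ht => le_trans ?_ (hK g)⟩
  rw [intervalIntegral.integral_of_le ht.1, integral_Ioc_eq_integral_Ioo]
  exact integral_mono_measure (Measure.restrict_mono (Ioo_subset_Ioo_right ht.2) le_rfl)
    (.of_forall fun _ => norm_nonneg _) ((Lp.memLp g).integrable Fact.out).norm

namespace W1p

variable [NormedSpace ℂ E]

theorem sub_apply (w z : W1p E p T) {t : ℝ} (ht : t ∈ Icc 0 T) : (w - z) t = w t - z t := by
  change w.init - z.init + ∫ s in (0 : ℝ)..t, (w.der - z.der : LpI E p T) s = _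
  rw [integral_congr_of_ae_eq (Lp.coeFn_sub w.der z.der) ht, toFun, toFun, add_sub_add_comm,
    ← intervalIntegral.integral_sub (intervalIntegrable_coeFn _ ht)
      (intervalIntegrable_coeFn _ ht)]
  rfl

theorem continuousOn (w : W1p E p T) : ContinuousOn w (Icc 0 T) := by
  rcases lt_or_ge T 0 with hT | hT
  · simp only [Icc_eq_empty_of_lt hT, continuousOn_empty]
  · exact continuousOn_const.add
      (continuousOn_primitive_Icc hT (intervalIntegrable_coeFn w.der ⟨hT, le_rfl⟩))

/-- The embedding of `W^{1,p}(0, T; E)` into `L^p(0, T; E)`. -/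
def toLp (w : W1p E p T) : LpI E p T := (memLp_of_continuousOn_Icc w.continuousOn).toLp w

theorem coeFn_toLp (w : W1p E p T) : w.toLp =ᵐ[intervalMeasure T] w := MemLp.coeFn_toLp _

theorem toLp_eq_of_ae_eq {w : W1p E p T} {g : LpI E p T} (h : w =ᵐ[intervalMeasure T] g) :
    w.toLp = g :=
  Lp.ext (w.coeFn_toLp.trans h)

theorem toLp_zero : (0 : W1p E p T).toLp = 0 :=
  toLp_eq_of_ae_eq <| (Lp.coeFn_zero E p (intervalMeasure T)).mp
    (ae_intervalMeasure_of_forall_mem_Icc fun _ ht h0 => (zero_apply ht).trans h0.symm)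

theorem toLp_sub (w z : W1p E p T) : (w - z).toLp = w.toLp - z.toLp := by
  refine toLp_eq_of_ae_eq ?_
  filter_upwards [w.coeFn_toLp, z.coeFn_toLp, Lp.coeFn_sub w.toLp z.toLp,
    ae_intervalMeasure_of_forall_mem_Icc fun _ => sub_apply w z] with t hw hz hsub hwz
  rw [hwz, hsub, Pi.sub_apply, hw, hz]

theorem norm_toLp_le_of_forall_norm_apply_le {w : W1p E p T} {c : ℝ} (hc : 0 ≤ c)
    (h : ∀ t ∈ Icc 0 T, ‖w t‖ ≤ c) :
    ‖w.toLp‖ ≤ measureUnivNNReal (intervalMeasure T) ^ p.toReal⁻¹ * c :=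
  Lp.norm_le_of_ae_bound hc (w.coeFn_toLp.mp
    ((ae_intervalMeasure_of_forall_mem_Icc h).mono fun _ ht hw => by rwa [hw]))

theorem exists_norm_toLp_le_of_init_eq_zero (E : Type*) [NormedAddCommGroup E] [NormedSpace ℂ E]
    (p : ℝ≥0∞) [Fact (1 ≤ p)] (T : ℝ) :
    ∃ K : ℝ≥0, ∀ w : W1p E p T, w.init = 0 → ‖w.toLp‖ ≤ K * ‖w.der‖ := by
  obtain ⟨K, hK⟩ := exists_intervalIntegral_norm_le E p T
  refine ⟨measureUnivNNReal (intervalMeasure T) ^ p.toReal⁻¹ * K, fun w hw => ?_⟩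
  push_cast
  rw [mul_assoc]
  refine norm_toLp_le_of_forall_norm_apply_le (by positivity) fun t ht => ?_
  rw [toFun, hw, zero_add]
  exact (intervalIntegral.norm_integral_le_integral_norm ht.1).trans (hK w.der t ht)

theorem exists_norm_init_le (E : Type*) [NormedAddCommGroup E] [NormedSpace ℂ E] (p : ℝ≥0∞)
    [hp : Fact (1 ≤ p)] (hT : 0 < T) :
    ∃ K : ℝ≥0, ∀ w : W1p E p T, ‖w.init‖ ≤ K * (‖w.toLp‖ + ‖w.der‖) := by
  have := neZero_intervalMeasure hT
  obtain ⟨K, hK⟩ := exists_norm_toLp_le_of_init_eq_zero E p T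
  set κ : ℝ := (intervalMeasure T).real univ ^ (1 / p.toReal)
  have hκ : 0 < κ := Real.rpow_pos_of_pos measureReal_univ_pos _
  refine ⟨(1 + K) * κ⁻¹.toNNReal, fun w => ?_⟩
  set v : W1p E p T := ⟨0, w.der⟩
  have hconst : Lp.const p (intervalMeasure T) w.init = w.toLp - v.toLp := by
    refine Lp.ext ?_
    filter_upwards [Lp.coeFn_const p (intervalMeasure T) w.init, Lp.coeFn_sub w.toLp v.toLp,
      w.coeFn_toLp, v.coeFn_toLp] with t hc hsub hw hv
    rw [hc, hsub, Pi.sub_apply, hw, hv, toFun, toFun, zero_add, add_sub_cancel_right,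
      Function.const_apply]
  have hle : ‖w.init‖ * κ ≤ (1 + K) * (‖w.toLp‖ + ‖w.der‖) := by
    rw [← Lp.norm_const p _ w.init (zero_lt_one.trans_le hp.out).ne', hconst]
    have hv := norm_sub_le_of_le (le_refl ‖w.toLp‖) (hK v rfl)
    nlinarith [norm_nonneg w.der, mul_nonneg K.coe_nonneg (norm_nonneg w.toLp)]
  rw [← le_div_iff₀ hκ] at hle
  push_cast
  rwa [Real.coe_toNNReal _ (inv_nonneg.2 hκ.le), mul_right_comm, ← div_eq_mul_inv]

theorem denseRange_toLp [CompleteSpace E] (hp : p ≠ ∞) :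
    DenseRange (toLp : W1p E p T → LpI E p T) := by
  refine fun f => Metric.mem_closure_iff.2 fun ε hε => ?_
  have : IsFiniteMeasureOnCompacts (intervalMeasure T) := inferInstance
  obtain ⟨k, -, hk, hkε⟩ := (Lp.memLp f).exist_eLpNorm_sub_le hp Fact.out (half_pos hε)
  obtain ⟨w, hw⟩ := exists_apply_eq_of_contDiff (p := p) (T := T)
    (hk.of_le (mod_cast le_top) : ContDiff ℝ 1 k)
  refine ⟨w.toLp, mem_range_self w, ?_⟩
  have hfw : ⇑f - k =ᵐ[intervalMeasure T] ⇑f - ⇑w.toLp := by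
    filter_upwards [w.coeFn_toLp, ae_intervalMeasure_of_forall_mem_Icc hw] with t hwt hkt
    rw [Pi.sub_apply, Pi.sub_apply, hwt, hkt]
  rw [Lp.dist_def, ← eLpNorm_congr_ae hfw]
  exact (ENNReal.toReal_le_of_le_ofReal (half_pos hε).le hkε).trans_lt (half_lt_self hε)

end W1p

end LpSpaces

/-! ### The scalar Cauchy problem in `L^p` -/

section CauchyProblem

variable {E : Type*} [NormedAddCommGroup E] [NormedSpace ℂ E] {p : ℝ≥0∞} {T : ℝ}
  {A : E →ₗ.[ℂ] E}

/-- The equation `w' = A w + f`, almost everywhere on `(0, T)`, in terms of the graph of `A`. -/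
def SolvesAE (A : E →ₗ.[ℂ] E) (f : ℝ → E) (w : W1p E p T) : Prop :=
  ∀ᵐ t ∂intervalMeasure T, (w t, w.der t - f t) ∈ A.graph

theorem mem_graph_sub_iff {x y z : E} :
    (x, y - z) ∈ A.graph ↔ ∃ hx : x ∈ A.domain, y = A ⟨x, hx⟩ + z := by
  rw [LinearPMap.mem_graph_iff]
  constructor
  · rintro ⟨u, rfl, hu⟩
    exact ⟨u.2, sub_eq_iff_eq_add.1 hu.symm⟩
  · rintro ⟨hx, rfl⟩
    exact ⟨⟨x, hx⟩, rfl, (add_sub_cancel_right _ _).symm⟩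

theorem solvesAE_iff {f : ℝ → E} {w : W1p E p T} : SolvesAE A f w ↔
    ∀ᵐ t ∂intervalMeasure T, ∃ ht : w t ∈ A.domain, w.der t = A ⟨w t, ht⟩ + f t := by
  simp only [SolvesAE, mem_graph_sub_iff]

theorem SolvesAE.congr {f k : ℝ → E} {w : W1p E p T} (hw : SolvesAE A f w)
    (hfk : f =ᵐ[intervalMeasure T] k) : SolvesAE A k w := by
  filter_upwards [hw, hfk] with t hwt hfkt
  rwa [← hfkt]

theorem SolvesAE.zero : SolvesAE A (0 : LpI E p T) (0 : W1p E p T) := by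
  filter_upwards [ae_intervalMeasure_of_forall_mem_Icc (T := T) fun _ =>
    W1p.zero_apply (E := E) (p := p)] with t happly
  rw [happly]
  change ((0 : E), (0 : LpI E p T) t - (0 : LpI E p T) t) ∈ A.graph
  rw [sub_self]
  exact A.graph.zero_mem

variable [hp : Fact (1 ≤ p)]

theorem SolvesAE.sub {f k : ℝ → E} {w z : W1p E p T} (hw : SolvesAE A f w)
    (hz : SolvesAE A k z) : SolvesAE A (f - k) (w - z) := by
  filter_upwards [hw, hz, Lp.coeFn_sub w.der z.der,
    ae_intervalMeasure_of_forall_mem_Icc fun _ => W1p.sub_apply w z] with t hwt hzt hder hsub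
  have hmem := A.graph.sub_mem hwt hzt
  rw [Prod.mk_sub_mk, sub_sub_sub_comm] at hmem
  rw [hsub]
  change (w t - z t, (w.der - z.der : LpI E p T) t - (f - k) t) ∈ A.graph
  rwa [hder]

variable [CompleteSpace E] {ω C : ℝ}

theorem HilleYosida.exists_norm_apply_le (hHY : HilleYosida A ω C) (p : ℝ≥0∞) [Fact (1 ≤ p)]
    (T : ℝ) :
    ∃ K : ℝ≥0, ∀ (f : LpI E p T) (w : W1p E p T), SolvesAE A f w → ∀ t ∈ Icc 0 T,
      ‖w t‖ ≤ K * (‖w.init‖ + ‖f‖) := by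
  obtain ⟨M, ⟨Y⟩⟩ := hHY.exists_yosidaSystem T
  obtain ⟨K, hK⟩ := exists_intervalIntegral_norm_le E p T
  refine ⟨M * (1 + M * K), fun f w hw t ht => ?_⟩
  have hle : ‖w t‖ ≤ M * (‖w.init‖ + M * ∫ s in (0 : ℝ)..t, ‖f s‖) :=
    Y.norm_primitive_le_of_ae_mem_graph ht (intervalIntegrable_coeFn w.der ht)
      (intervalIntegrable_coeFn f ht)
      (ae_mono (Measure.restrict_mono (Ioo_subset_Ioo_right ht.2) le_rfl) hw)
  calc ‖w t‖ ≤ M * (‖w.init‖ + M * (K * ‖f‖)) := hle.trans (by gcongr; exact hK f t ht)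
    _ ≤ M * (‖w.init‖ + M * (K * ‖f‖)) + M * (M * K * ‖w.init‖ + ‖f‖) :=
      le_add_of_nonneg_right (by positivity)
    _ = (M * (1 + M * K) : ℝ≥0) * (‖w.init‖ + ‖f‖) := by push_cast; ring

theorem HilleYosida.exists_norm_toLp_le (hHY : HilleYosida A ω C) (p : ℝ≥0∞) [Fact (1 ≤ p)]
    (T : ℝ) :
    ∃ K : ℝ≥0, ∀ (f : LpI E p T) (w : W1p E p T), SolvesAE A f w →
      ‖w.toLp‖ ≤ K * (‖w.init‖ + ‖f‖) := by
  obtain ⟨K, hK⟩ := hHY.exists_norm_apply_le p T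
  refine ⟨measureUnivNNReal (intervalMeasure T) ^ p.toReal⁻¹ * K, fun f w hw => ?_⟩
  push_cast
  rw [mul_assoc]
  exact W1p.norm_toLp_le_of_forall_norm_apply_le (by positivity) (hK f w hw)

theorem SolvesAE.unique (hHY : HilleYosida A ω C) (hT : 0 < T) {f : ℝ → E} {w z : W1p E p T}
    (hw : SolvesAE A f w) (hz : SolvesAE A f z) (hinit : w.init = z.init) : w = z := by
  obtain ⟨K, hK⟩ := hHY.exists_norm_apply_le p T
  have hsub : SolvesAE A (0 : LpI E p T) (w - z) :=
    (hw.sub hz).congr (by rw [sub_self]; exact (Lp.coeFn_zero E p _).symm)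
  refine W1p.ext_of_eqOn hp.out hT fun t ht => sub_eq_zero.1 (norm_le_zero_iff.1 ?_)
  have hle := hK 0 _ hsub t ht
  rwa [W1p.sub_apply w z ht, norm_zero, add_zero, show (w - z).init = 0 from sub_eq_zero.2 hinit,
    norm_zero, mul_zero] at hle

theorem HilleYosida.exists_solvesAE_norm_der_le (hHY : HilleYosida A ω C) (hA : A.IsClosed)
    (p : ℝ≥0∞) [Fact (1 ≤ p)] (hT : 0 ≤ T) :
    ∃ K : ℝ≥0, ∀ (f : W1p E p T) (u₀ a₀ : E), (u₀, a₀) ∈ A.graph →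
      a₀ + f.init ∈ closure (A.domain : Set E) → ∃ u : W1p E p T,
        u.init = u₀ ∧ SolvesAE A f u ∧ ‖u.der‖ ≤ K * (‖a₀ + f.init‖ + ‖f.der‖) := by
  obtain ⟨M, ⟨Y⟩⟩ := hHY.exists_yosidaSystem T
  obtain ⟨K, hK⟩ := exists_intervalIntegral_norm_le E p T
  have hTmem : T ∈ Icc 0 T := ⟨hT, le_rfl⟩
  refine ⟨measureUnivNNReal (intervalMeasure T) ^ p.toReal⁻¹ * (M * (1 + K)),
    fun f u₀ a₀ hu hcl => ?_⟩
  have hfder := intervalIntegrable_coeFn f.der hTmem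
  set v := Y.mildLimit (a₀ + f.init) f.der
  have hbound : ∀ᵐ t ∂intervalMeasure T, ‖v t‖ ≤ M * (‖a₀ + f.init‖ + K * ‖f.der‖) :=
    ae_intervalMeasure_of_forall_mem_Icc fun t ht =>
      (Y.norm_mildLimit_le hcl ht hfder).trans (by gcongr; exact hK f.der T hTmem)
  have hmeas : AEStronglyMeasurable v (intervalMeasure T) :=
    (Y.aestronglyMeasurable_mildLimit hT hcl hfder).mono_measure
      (Measure.restrict_mono Ioo_subset_Icc_self le_rfl)
  have hv : MemLp v p (intervalMeasure T) := MemLp.of_bound hmeas _ hbound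
  refine ⟨⟨u₀, hv.toLp v⟩, rfl, ?_, ?_⟩
  · filter_upwards [hv.coeFn_toLp, ae_restrict_mem measurableSet_Ioo] with t hvt ht
    rw [W1p.mk_toLp_apply u₀ hv (Ioo_subset_Icc_self ht), hvt]
    exact Y.primitive_mildLimit_mem_graph hA hu hcl (Ioo_subset_Icc_self ht) hfder
  · refine (Lp.norm_le_of_ae_bound (by positivity)
      (hv.coeFn_toLp.mp (hbound.mono fun t ht hvt => hvt ▸ ht))).trans ?_
    push_cast
    rw [mul_assoc, mul_assoc (M : ℝ)]
    gcongr
    nlinarith [mul_nonneg K.coe_nonneg (norm_nonneg (a₀ + f.init)), norm_nonneg f.der]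

theorem HilleYosida.exists_solvesAE (hHY : HilleYosida A ω C) (hA : A.IsClosed)
    (p : ℝ≥0∞) [Fact (1 ≤ p)] (hT : 0 < T) :
    ∃ K : ℝ≥0, ∀ (f : W1p E p T) (u₀ a₀ : E), (u₀, a₀) ∈ A.graph →
      a₀ + f.init ∈ closure (A.domain : Set E) → ∃ u : W1p E p T,
        u.init = u₀ ∧ SolvesAE A f u ∧ ‖u.der‖ ≤ K * (‖a₀‖ + (‖f.toLp‖ + ‖f.der‖)) := by
  obtain ⟨K, hK⟩ := hHY.exists_solvesAE_norm_der_le hA p hT.le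
  obtain ⟨L, hL⟩ := W1p.exists_norm_init_le E p hT
  refine ⟨K * (1 + L), fun f u₀ a₀ hu hcl => ?_⟩
  obtain ⟨u, hinit, hsol, hder⟩ := hK f u₀ a₀ hu hcl
  refine ⟨u, hinit, hsol, hder.trans ?_⟩
  push_cast
  rw [mul_assoc]
  gcongr
  nlinarith [norm_add_le a₀ f.init, hL f, norm_nonneg f.toLp,
    mul_nonneg L.coe_nonneg (norm_nonneg a₀)]

theorem HilleYosida.closure_domain_subset_closure_compatible (hHY : HilleYosida A ω C) (y : E) :
    closure (A.domain : Set E) ⊆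
      closure {x | ∃ a, (x, a) ∈ A.graph ∧ a + y ∈ closure (A.domain : Set E)} := by
  obtain ⟨M, ⟨Y⟩⟩ := hHY.exists_yosidaSystem 0
  refine closure_minimal (fun x hx => ?_) isClosed_closure
  obtain ⟨z, hz⟩ := LinearPMap.mem_domain_iff.1 hx
  have hlim := (Y.tendsto_J_apply (subset_closure hx)).add (Y.tendsto_R_apply y)
  rw [add_zero] at hlim
  refine mem_closure_of_tendsto hlim (.of_forall fun n =>
    ⟨Y.B n x + (Y.J n y - y), A.graph.add_mem (Y.J_mem_graph n x) (Y.R_mem_graph n y), ?_⟩)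
  rw [add_assoc, sub_add_cancel, Y.B_apply_of_mem_graph n hz]
  exact subset_closure (A.domain.add_mem (Y.J_mem_domain n z) (Y.J_mem_domain n y))

end CauchyProblem

/-! ### Limits of strict solutions -/

theorem norm_snd_le_of_mem_topologicalClosure {X Y : Type*} [NormedAddCommGroup X]
    [NormedAddCommGroup Y] {Γ : AddSubgroup (X × Y)} {K : ℝ} (hΓ : ∀ x ∈ Γ, ‖x.2‖ ≤ K * ‖x.1‖)
    {x : X × Y} (hx : x ∈ Γ.topologicalClosure) : ‖x.2‖ ≤ K * ‖x.1‖ :=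
  closure_minimal hΓ
    (isClosed_le continuous_snd.norm (continuous_const.mul continuous_fst.norm)) hx

theorem exists_mem_topologicalClosure {X Y : Type*} [NormedAddCommGroup X]
    [NormedAddCommGroup Y] [CompleteSpace Y] {Γ : AddSubgroup (X × Y)} {K : ℝ}
    (hΓ : ∀ x ∈ Γ, ‖x.2‖ ≤ K * ‖x.1‖) {x : X} (hx : x ∈ closure (Prod.fst '' (Γ : Set (X × Y)))) :
    ∃ y, (x, y) ∈ Γ.topologicalClosure := by
  obtain ⟨a, haΓ, ha⟩ := mem_closure_iff_seq_limit.1 hx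
  choose γ hγ hγa using haΓ
  have hcauchy : CauchySeq fun n => (γ n).2 :=
    cauchySeq_of_dist_le_mul K (fun m n => by
      rw [dist_eq_norm, dist_eq_norm, ← hγa, ← hγa]
      exact hΓ _ (Γ.sub_mem (hγ m) (hγ n))) ha.cauchySeq
  obtain ⟨y, hy⟩ := cauchySeq_tendsto_of_complete hcauchy
  have hfst : Tendsto (fun n => (γ n).1) atTop (𝓝 x) := by simpa only [hγa] using ha
  exact ⟨y, mem_closure_of_tendsto (hfst.prodMk_nhds hy) (.of_forall hγ)⟩

section LimitSolutions

variable {E : Type*} [NormedAddCommGroup E] [NormedSpace ℂ E] {p : ℝ≥0∞} [Fact (1 ≤ p)] {T : ℝ}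
  {A : E →ₗ.[ℂ] E}

/-- The solution operator `(f, u₀) ↦ u` of strict solutions in `L^p(0, T; E)`, as a graph. The graph
of the solution operator for `F`-solutions is its closure. -/
def strictGraph (A : E →ₗ.[ℂ] E) (p : ℝ≥0∞) [Fact (1 ≤ p)] (T : ℝ) :
    AddSubgroup ((LpI E p T × E) × LpI E p T) :=
  AddSubgroup.ofSub
    {x | ∃ w : W1p E p T, SolvesAE A x.1.1 w ∧ w.init = x.1.2 ∧ w.toLp = x.2}
    ⟨0, 0, SolvesAE.zero, rfl, W1p.toLp_zero⟩ <| by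
      rintro ⟨⟨f, _⟩, _⟩ ⟨w, hw, rfl, rfl⟩ ⟨⟨k, _⟩, _⟩ ⟨z, hz, rfl, rfl⟩
      rw [← sub_eq_add_neg]
      exact ⟨w - z, (hw.sub hz).congr (Lp.coeFn_sub f k).symm, rfl, W1p.toLp_sub w z⟩

variable [CompleteSpace E] {ω C : ℝ}

theorem HilleYosida.exists_norm_le_of_mem_strictGraph (hHY : HilleYosida A ω C) (p : ℝ≥0∞)
    [Fact (1 ≤ p)] (T : ℝ) :
    ∃ K : ℝ≥0, ∀ x ∈ strictGraph A p T, ‖x.2‖ ≤ K * ‖x.1‖ := by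
  obtain ⟨K, hK⟩ := hHY.exists_norm_toLp_le p T
  refine ⟨K * 2, ?_⟩
  rintro ⟨⟨f, _⟩, _⟩ ⟨w, hw, rfl, rfl⟩
  refine (hK f w hw).trans ?_
  push_cast
  rw [mul_assoc, two_mul]
  exact mul_le_mul_of_nonneg_left
    (add_le_add (norm_snd_le (f, w.init)) (norm_fst_le (f, w.init))) K.coe_nonneg

theorem HilleYosida.exists_norm_le_of_mem_topologicalClosure (hHY : HilleYosida A ω C)
    (p : ℝ≥0∞) [Fact (1 ≤ p)] (T : ℝ) :
    ∃ K : ℝ≥0, ∀ x ∈ (strictGraph A p T).topologicalClosure, ‖x.2‖ ≤ K * ‖x.1‖ :=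
  (hHY.exists_norm_le_of_mem_strictGraph p T).imp fun _ hK _ =>
    norm_snd_le_of_mem_topologicalClosure hK

theorem eq_of_mem_topologicalClosure_strictGraph (hHY : HilleYosida A ω C)
    {d : LpI E p T × E} {U V : LpI E p T} (hU : (d, U) ∈ (strictGraph A p T).topologicalClosure)
    (hV : (d, V) ∈ (strictGraph A p T).topologicalClosure) : U = V := by
  obtain ⟨K, hK⟩ := hHY.exists_norm_le_of_mem_topologicalClosure p T
  have hle := hK _ (sub_mem hU hV)
  rw [Prod.mk_sub_mk, sub_self, norm_zero, mul_zero] at hle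
  exact sub_eq_zero.1 (norm_le_zero_iff.1 hle)

theorem mem_closure_fst_image_strictGraph (hHY : HilleYosida A ω C) (hA : A.IsClosed)
    (hp : p ≠ ∞) (hT : 0 < T) (f : LpI E p T) {u₀ : E} (hu₀ : u₀ ∈ closure (A.domain : Set E)) :
    (f, u₀) ∈ closure (Prod.fst '' (strictGraph A p T : Set ((LpI E p T × E) × LpI E p T))) := by
  set D := Prod.fst '' (strictGraph A p T : Set ((LpI E p T × E) × LpI E p T))
  obtain ⟨K, hK⟩ := hHY.exists_solvesAE hA p hT
  have hsmooth : ∀ F : W1p E p T, (F.toLp, u₀) ∈ closure D := fun F => by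
    refine map_mem_closure (f := Prod.mk F.toLp) (by fun_prop)
      (hHY.closure_domain_subset_closure_compatible F.init hu₀) ?_
    rintro x ⟨a, hxa, hcl⟩
    obtain ⟨w, hinit, hw, -⟩ := hK F x a hxa hcl
    exact ⟨((F.toLp, x), w.toLp), ⟨w, hw.congr F.coeFn_toLp.symm, hinit, rfl⟩, rfl⟩
  rw [← closure_closure]
  exact map_mem_closure (f := fun g => (g, u₀)) (by fun_prop) (W1p.denseRange_toLp hp f)
    (forall_mem_range.2 hsmooth)

theorem exists_mem_topologicalClosure_strictGraph (hHY : HilleYosida A ω C) (hA : A.IsClosed)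
    (hp : p ≠ ∞) (hT : 0 < T) (f : LpI E p T) {u₀ : E} (hu₀ : u₀ ∈ closure (A.domain : Set E)) :
    ∃ U, ((f, u₀), U) ∈ (strictGraph A p T).topologicalClosure :=
  exists_mem_topologicalClosure (hHY.exists_norm_le_of_mem_strictGraph p T).choose_spec
    (mem_closure_fst_image_strictGraph hHY hA hp hT f hu₀)

end LimitSolutions

/-! ### Weighted sums of powers -/

section WeightedPowSum

variable {ι : Type*} {c a b : ι → ℝ≥0∞} {r : ℝ}

/-- The `r`-th power of the weighted `ℓ^r` norm of `a`, with weights `c`. -/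
def weightedPowSum (c : ι → ℝ≥0∞) (r : ℝ) (a : ι → ℝ≥0∞) : ℝ≥0∞ := ∑' i, c i * a i ^ r

theorem weightedPowSum_mono (hr : 0 ≤ r) (hab : ∀ i, a i ≤ b i) :
    weightedPowSum c r a ≤ weightedPowSum c r b :=
  ENNReal.tsum_le_tsum fun i => by gcongr; exact hab i

theorem weightedPowSum_const_mul (hr : 0 ≤ r) (k : ℝ≥0∞) (a : ι → ℝ≥0∞) :
    weightedPowSum c r (fun i => k * a i) = k ^ r * weightedPowSum c r a := by
  rw [weightedPowSum, weightedPowSum, ← ENNReal.tsum_mul_left]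
  exact tsum_congr fun i => by rw [ENNReal.mul_rpow_of_nonneg _ _ hr, mul_left_comm]

theorem weightedPowSum_const_mul_lt_top (hr : 0 ≤ r) {k : ℝ≥0∞} (hk : k ≠ ∞)
    (ha : weightedPowSum c r a < ∞) : weightedPowSum c r (fun i => k * a i) < ∞ := by
  rw [weightedPowSum_const_mul hr]
  exact ENNReal.mul_lt_top (ENNReal.rpow_lt_top_of_nonneg hr hk) ha

theorem weightedPowSum_add_lt_top (hr : 1 ≤ r) (ha : weightedPowSum c r a < ∞)
    (hb : weightedPowSum c r b < ∞) : weightedPowSum c r (fun i => a i + b i) < ∞ := by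
  have hle : weightedPowSum c r (fun i => a i + b i) ≤
      2 ^ (r - 1) * (weightedPowSum c r a + weightedPowSum c r b) := by
    simp only [weightedPowSum, ← ENNReal.tsum_add, ← ENNReal.tsum_mul_left]
    refine ENNReal.tsum_le_tsum fun i => ?_
    rw [← mul_add, mul_left_comm]
    gcongr
    exact ENNReal.rpow_add_le_mul_rpow_add_rpow _ _ hr
  exact hle.trans_lt (ENNReal.mul_lt_top
    (ENNReal.rpow_lt_top_of_nonneg (sub_nonneg.2 hr) ENNReal.ofNat_ne_top)
    (ENNReal.add_lt_top.2 ⟨ha, hb⟩))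

theorem weightedPowSum_lt_top_of_finite_support (hr : 0 < r) (hc : ∀ i, c i ≠ ∞)
    (ha : ∀ i, a i ≠ ∞) (hfin : a.support.Finite) : weightedPowSum c r a < ∞ := by
  rw [weightedPowSum, tsum_eq_sum (s := hfin.toFinset)]
  · exact ENNReal.sum_lt_top.2 fun i _ =>
      ENNReal.mul_lt_top (hc i).lt_top (ENNReal.rpow_lt_top_of_nonneg hr.le (ha i))
  · intro i hi
    rw [Function.notMem_support.1 (mt hfin.mem_toFinset.2 hi), ENNReal.zero_rpow_of_pos hr,
      mul_zero]

theorem tendsto_rpow_nhds_zero_iff {l : Filter ι} (hr : 0 < r) :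
    Tendsto (fun i => a i ^ r) l (𝓝 0) ↔ Tendsto a l (𝓝 0) := by
  have rpow_tendsto : ∀ {b : ι → ℝ≥0∞} {y : ℝ}, 0 < y → Tendsto b l (𝓝 0) →
      Tendsto (fun i => b i ^ y) l (𝓝 0) := fun {b y} hy hb => by
    simpa only [ENNReal.zero_rpow_of_pos hy] using hb.ennrpow_const y
  refine ⟨fun h => (rpow_tendsto (inv_pos.2 hr) h).congr fun i => ?_, rpow_tendsto hr⟩
  exact ENNReal.rpow_rpow_inv hr.ne' _

theorem tendsto_add_add_nhds_zero_iff {l : Filter ι} :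
    Tendsto (fun k => a k + b k + c k) l (𝓝 0) ↔
      Tendsto a l (𝓝 0) ∧ Tendsto b l (𝓝 0) ∧ Tendsto c l (𝓝 0) := by
  refine ⟨fun hlim => ?_, fun ⟨ha, hb, hc⟩ => by simpa only [add_zero] using (ha.add hb).add hc⟩
  have of_le : ∀ {d : ι → ℝ≥0∞}, (∀ k, d k ≤ a k + b k + c k) → Tendsto d l (𝓝 0) :=
    tendsto_of_tendsto_of_tendsto_of_le_of_le tendsto_const_nhds hlim (fun _ => zero_le)
  exact ⟨of_le fun k => le_self_add.trans le_self_add, of_le fun k => le_add_self.trans le_self_add,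
    of_le fun k => le_add_self⟩

theorem tendsto_apply_of_tendsto_weightedPowSum {κ : Type*} {l : Filter κ} {a : κ → ι → ℝ≥0∞}
    (hr : 0 < r) {i : ι} (hc₀ : c i ≠ 0) (hc : c i ≠ ∞)
    (ha : Tendsto (fun k => weightedPowSum c r (a k)) l (𝓝 0)) :
    Tendsto (fun k => a k i) l (𝓝 0) := by
  have hlim : Tendsto (fun k => (c i)⁻¹ * weightedPowSum c r (a k)) l (𝓝 0) := by
    simpa only [mul_zero] using ENNReal.Tendsto.const_mul ha (.inr (ENNReal.inv_ne_top.2 hc₀))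
  refine (tendsto_rpow_nhds_zero_iff hr).1 (tendsto_of_tendsto_of_tendsto_of_le_of_le
    tendsto_const_nhds hlim (fun _ => zero_le) fun k => ?_)
  rw [mul_comm, ← div_eq_mul_inv, ENNReal.le_div_iff_mul_le (.inl hc₀) (.inl hc), mul_comm]
  exact ENNReal.le_tsum i

theorem exists_pos_weightedPowSum_lt [Countable ι] (hr : 0 < r) (hc : ∀ i, c i ≠ ∞) {ε : ℝ≥0∞}
    (hε : ε ≠ 0) : ∃ δ : ι → ℝ≥0∞, (∀ i, 0 < δ i) ∧ weightedPowSum c r δ < ε := by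
  obtain ⟨δ, hδ, hsum⟩ := ENNReal.exists_pos_tsum_mul_lt_of_countable hε c hc
  refine ⟨fun i => (δ i : ℝ≥0∞) ^ r⁻¹, fun i => ENNReal.rpow_pos (by exact_mod_cast hδ i) (by simp),
    ?_⟩
  simpa only [weightedPowSum, ENNReal.rpow_inv_rpow hr.ne'] using hsum

theorem exists_pos_tendsto_weightedPowSum [Countable ι] (hr : 0 < r) (hc : ∀ i, c i ≠ ∞) :
    ∃ δ : ℕ → ι → ℝ≥0∞, (∀ k i, 0 < δ k i) ∧
      Tendsto (fun k => weightedPowSum c r (δ k)) atTop (𝓝 0) := by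
  choose δ hδ hlt using fun k : ℕ =>
    exists_pos_weightedPowSum_lt hr hc (ENNReal.inv_ne_zero.2 (ENNReal.natCast_ne_top k))
  exact ⟨δ, hδ, tendsto_of_tendsto_of_tendsto_of_le_of_le tendsto_const_nhds
    ENNReal.tendsto_inv_nat_nhds_zero (fun _ => zero_le) fun k => (hlt k).le⟩

theorem tendsto_weightedPowSum_of_head_of_tail {c a : ℕ → ℝ≥0∞} {b δ : ℕ → ℕ → ℝ≥0∞} (hr : 0 ≤ r)
    (ha : weightedPowSum c r a < ∞) (hδ : Tendsto (fun k => weightedPowSum c r (δ k)) atTop (𝓝 0))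
    (hhead : ∀ k, ∀ i < k, b k i ≤ δ k i) (htail : ∀ k i, k ≤ i → b k i ≤ a i) :
    Tendsto (fun k => weightedPowSum c r (b k)) atTop (𝓝 0) := by
  have hlim := hδ.add (ENNReal.tendsto_sum_nat_add (fun i => c i * a i ^ r) ha.ne)
  rw [add_zero] at hlim
  refine tendsto_of_tendsto_of_tendsto_of_le_of_le tendsto_const_nhds hlim (fun _ => zero_le)
    fun k => ?_
  calc weightedPowSum c r (b k)
      = ∑ i ∈ Finset.range k, c i * b k i ^ r + ∑' i, c (i + k) * b k (i + k) ^ r :=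
        (Summable.sum_add_tsum_nat_add' (f := fun i => c i * b k i ^ r) ENNReal.summable).symm
    _ ≤ ∑ i ∈ Finset.range k, c i * δ k i ^ r + ∑' i, c (i + k) * a (i + k) ^ r := by
        gcongr with i hi i
        · exact hhead k i (Finset.mem_range.1 hi)
        · exact htail k _ (Nat.le_add_left k i)
    _ ≤ weightedPowSum c r (δ k) + ∑' i, c (i + k) * a (i + k) ^ r := by
        gcongr
        exact ENNReal.sum_le_tsum _

end WeightedPowSum

/-! ### The ultradistributional sequence spaces -/

section SequenceSpaces

variable {p : ℝ≥0∞} {s h T : ℝ}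

theorem weight_pos (hh : 0 < h) (α : ℕ) : 0 < weight p s h α := by
  unfold weight
  positivity

/-- The sum `∑_α α!^{ps} / h^{pα} a_α^p`, the `p`-th power of the norm of the spaces
`\tilde D'^s_{L^p,h}` in terms of the norms `a_α` of the components. -/
abbrev gevreySum (p : ℝ≥0∞) (s h : ℝ) (a : ℕ → ℝ≥0∞) : ℝ≥0∞ :=
  weightedPowSum (fun α => ENNReal.ofReal (weight p s h α)) p.toReal a

theorem WeightedSummable.gevreySum_lt_top {X : Type*} [NormedAddCommGroup X] (hh : 0 < h)
    {x : ℕ → X} (hx : WeightedSummable p s h x) : gevreySum p s h (fun α => ‖x α‖ₑ) < ∞ := by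
  refine lt_of_eq_of_lt (tsum_congr fun α => ?_) hx.tsum_ofReal_lt_top
  beta_reduce
  rw [ENNReal.ofReal_mul (weight_pos hh α).le, ← ofReal_norm,
    ENNReal.ofReal_rpow_of_nonneg (norm_nonneg _) ENNReal.toReal_nonneg]

theorem seqNorm_eq_of_ae_eq {X : Type*} [NormedAddCommGroup X] {F : ℕ → ℝ → X}
    {G : ℕ → LpI X p T} (hFG : ∀ α, F α =ᵐ[intervalMeasure T] G α) :
    seqNorm p s h T F = gevreySum p s h (fun α => ‖G α‖ₑ) ^ (1 / p.toReal) := by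
  simp only [seqNorm, gevreySum, weightedPowSum, Lp.enorm_def, eLpNorm_congr_ae (hFG _)]

theorem tendsto_gevreySum_indicator_Iio_sub {X : Type*} [NormedAddCommGroup X] {x : ℕ → ℕ → X}
    {y : ℕ → X} {δ : ℕ → ℕ → ℝ≥0∞} (hy : gevreySum p s h (fun α => ‖y α‖ₑ) < ∞)
    (hδ : Tendsto (fun k => gevreySum p s h (δ k)) atTop (𝓝 0))
    (hxy : ∀ k α, ‖x k α - y α‖ₑ ≤ δ k α) :
    Tendsto (fun k => gevreySum p s h fun α => ‖(Iio k).indicator (x k) α - y α‖ₑ) atTop (𝓝 0) := by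
  refine tendsto_weightedPowSum_of_head_of_tail ENNReal.toReal_nonneg hy hδ (fun k α hα => ?_)
    fun k α hα => ?_
  · rw [indicator_of_mem (mem_Iio.2 hα)]
    exact hxy k α
  · rw [indicator_of_notMem (notMem_Iio.2 hα), zero_sub, enorm_neg]

variable [Fact (1 ≤ p)]

theorem one_le_toReal (hp : p ≠ ∞) : 1 ≤ p.toReal := (ENNReal.dichotomy p).resolve_left hp

theorem toReal_pos (hp : p ≠ ∞) : 0 < p.toReal := zero_lt_one.trans_le (one_le_toReal hp)

theorem gevreySum_lt_top_of_norm_le {X Y Z : Type*} [NormedAddCommGroup X] [NormedAddCommGroup Y]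
    [NormedAddCommGroup Z] (hp : p ≠ ∞) {K : ℝ≥0} {x : ℕ → X} {y : ℕ → Y} {z : ℕ → Z}
    (hle : ∀ α, ‖x α‖ ≤ K * (‖y α‖ + ‖z α‖)) (hy : gevreySum p s h (fun α => ‖y α‖ₑ) < ∞)
    (hz : gevreySum p s h (fun α => ‖z α‖ₑ) < ∞) : gevreySum p s h (fun α => ‖x α‖ₑ) < ∞ := by
  have hr := toReal_pos hp
  have henorm : ∀ α, ‖x α‖ₑ ≤ K * (‖y α‖ₑ + ‖z α‖ₑ) := fun α => by
    have hnn : ‖x α‖₊ ≤ K * (‖y α‖₊ + ‖z α‖₊) := hle α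
    simp only [enorm_eq_nnnorm]
    exact_mod_cast hnn
  exact (weightedPowSum_mono hr.le henorm).trans_lt (weightedPowSum_const_mul_lt_top hr.le
    ENNReal.coe_ne_top (weightedPowSum_add_lt_top (one_le_toReal hp) hy hz))

theorem gevreySum_indicator_Iio_lt_top {X : Type*} [NormedAddCommGroup X] (hp : p ≠ ∞)
    (x : ℕ → X) (k : ℕ) : gevreySum p s h (fun α => ‖(Iio k).indicator x α‖ₑ) < ∞ := by
  refine weightedPowSum_lt_top_of_finite_support (toReal_pos hp) (fun _ => ENNReal.ofReal_ne_top)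
    (fun _ => enorm_ne_top) ((finite_Iio k).subset fun α hα => ?_)
  exact mem_of_indicator_ne_zero (enorm_ne_zero.1 hα)

theorem seqNorm_lt_top_iff_of_ae_eq {X : Type*} [NormedAddCommGroup X] (hp : p ≠ ∞)
    {F : ℕ → ℝ → X} {G : ℕ → LpI X p T} (hFG : ∀ α, F α =ᵐ[intervalMeasure T] G α) :
    seqNorm p s h T F < ∞ ↔ gevreySum p s h (fun α => ‖G α‖ₑ) < ∞ := by
  rw [seqNorm_eq_of_ae_eq hFG, ENNReal.rpow_lt_top_iff_of_pos (one_div_pos.2 (toReal_pos hp))]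

theorem mem_seqLp_iff {X : Type*} [NormedAddCommGroup X] (hp : p ≠ ∞) {F : ℕ → LpI X p T} :
    F ∈ SeqLp X p s h T ↔ gevreySum p s h (fun α => ‖F α‖ₑ) < ∞ :=
  seqNorm_lt_top_iff_of_ae_eq hp fun _ => .rfl

theorem tendsto_seqNorm_iff_of_ae_eq {X : Type*} [NormedAddCommGroup X] (hp : p ≠ ∞)
    {F : ℕ → ℕ → ℝ → X} {G : ℕ → ℕ → LpI X p T} (hFG : ∀ k α, F k α =ᵐ[intervalMeasure T] G k α) :
    Tendsto (fun k => seqNorm p s h T (F k)) atTop (𝓝 0) ↔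
      Tendsto (fun k => gevreySum p s h (fun α => ‖G k α‖ₑ)) atTop (𝓝 0) := by
  simp only [seqNorm_eq_of_ae_eq (hFG _)]
  exact tendsto_rpow_nhds_zero_iff (one_div_pos.2 (toReal_pos hp))

theorem enorm_lp_const {X : Type*} [NormedAddCommGroup X] (hp : p ≠ ∞) (x : X) :
    ‖Lp.const p (intervalMeasure T) x‖ₑ =
      intervalMeasure T univ ^ (1 / p.toReal) * ‖x‖ₑ := by
  rw [← MemLp.toLp_const, Lp.enorm_toLp,
    eLpNorm_const' _ (ENNReal.toReal_pos_iff.1 (toReal_pos hp)).1.ne' hp, mul_comm]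

theorem tendsto_seqNorm_const_iff {X : Type*} [NormedAddCommGroup X] (hp : p ≠ ∞) (hT : 0 < T)
    {x : ℕ → ℕ → X} : Tendsto (fun k => seqNorm p s h T (fun α _ => x k α)) atTop (𝓝 0) ↔
      Tendsto (fun k => gevreySum p s h (fun α => ‖x k α‖ₑ)) atTop (𝓝 0) := by
  have := neZero_intervalMeasure hT
  have hpos := toReal_pos hp
  rw [tendsto_seqNorm_iff_of_ae_eq (F := fun k α _ => x k α) hp fun k α =>
    (Lp.coeFn_const p _ (x k α)).symm]
  simp only [enorm_lp_const hp, weightedPowSum_const_mul hpos.le, ← ENNReal.rpow_mul,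
    one_div_mul_cancel hpos.ne', ENNReal.rpow_one]
  refine ⟨fun hlim => ?_, fun hlim => by
    simpa only [mul_zero] using ENNReal.Tendsto.const_mul hlim (.inr (measure_ne_top _ _))⟩
  have hμ : intervalMeasure T univ ≠ 0 := NeZero.ne _
  simpa only [← mul_assoc, ENNReal.inv_mul_cancel hμ (measure_ne_top _ _), one_mul, mul_zero] using
    ENNReal.Tendsto.const_mul hlim (.inr (ENNReal.inv_ne_top.2 hμ))

variable {E : Type*} [NormedAddCommGroup E] [NormedSpace ℂ E]

theorem mem_seqW1p_iff (hp : p ≠ ∞) {F : ℕ → W1p E p T} : F ∈ SeqW1p E p s h T ↔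
    gevreySum p s h (fun α => ‖(F α).toLp‖ₑ) < ∞ ∧ gevreySum p s h (fun α => ‖(F α).der‖ₑ) < ∞ := by
  change seqSobolevNorm p s h T F < ∞ ↔ _
  rw [seqSobolevNorm, ENNReal.rpow_lt_top_iff_of_pos (one_div_pos.2 (toReal_pos hp)),
    ← ENNReal.add_lt_top]
  simp only [gevreySum, weightedPowSum, mul_add, ENNReal.tsum_add, Lp.enorm_def,
    eLpNorm_congr_ae (W1p.coeFn_toLp _)]

theorem seqNorm_lt_top_of_mem_seqW1p (hp : p ≠ ∞) {F : ℕ → W1p E p T} (hF : F ∈ SeqW1p E p s h T) :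
    seqNorm p s h T (fun α => F α) < ∞ :=
  (seqNorm_lt_top_iff_of_ae_eq hp fun α => (F α).coeFn_toLp.symm).2 ((mem_seqW1p_iff hp).1 hF).1

end SequenceSpaces

/-! ### The pairing with test functions -/

section Pairing

variable {p q : ℝ≥0∞} {s h T : ℝ}

/-- The ratio `h^α / α!^s`: the weights of the test functions are its powers, and those of the
sequence spaces are the powers of its inverse. -/
def gevreyRatio (s h : ℝ) (α : ℕ) : ℝ≥0∞ := ENNReal.ofReal (h ^ α / (Nat.factorial α : ℝ) ^ s)

theorem gevreyRatio_rpow (hh : 0 < h) (α : ℕ) (x : ℝ) : gevreyRatio s h α ^ x =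
    ENNReal.ofReal (h ^ (x * α) / (Nat.factorial α : ℝ) ^ (x * s)) := by
  rw [gevreyRatio, ENNReal.ofReal_rpow_of_pos (by positivity),
    Real.div_rpow (by positivity) (by positivity), ← Real.rpow_natCast, ← Real.rpow_mul hh.le,
    ← Real.rpow_mul (by positivity : (0 : ℝ) ≤ α.factorial), mul_comm (α : ℝ), mul_comm s]

theorem gevreyRatio_ne_zero (hh : 0 < h) (α : ℕ) : gevreyRatio s h α ≠ 0 := by
  exact (ENNReal.ofReal_pos.2 (by positivity)).ne'

theorem gevreyRatio_ne_top (α : ℕ) : gevreyRatio s h α ≠ ∞ := ENNReal.ofReal_ne_top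

theorem gevreySum_eq_tsum (hh : 0 < h) (a : ℕ → ℝ≥0∞) :
    gevreySum p s h a = ∑' α, ((gevreyRatio s h α)⁻¹ * a α) ^ p.toReal := by
  refine tsum_congr fun α => ?_
  rw [ENNReal.mul_rpow_of_nonneg _ _ ENNReal.toReal_nonneg, ENNReal.inv_rpow, gevreyRatio_rpow hh,
    ← ENNReal.ofReal_inv_of_pos (by have := Nat.factorial_pos α; positivity), inv_div]
  rfl

theorem testNorm_eq_tsum (hh : 0 < h) (hq : q ≠ ∞) (φ : ℝ → ℂ) : testNorm q s h T φ =
    (∑' α, (gevreyRatio s h α * eLpNorm (iteratedDeriv α φ) q (intervalMeasure T)) ^ q.toReal) ^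
      (1 / q.toReal) := by
  simp only [testNorm, if_neg hq, ENNReal.mul_rpow_of_nonneg _ _ ENNReal.toReal_nonneg,
    gevreyRatio_rpow hh]

theorem gevreyRatio_mul_eLpNorm_le_testNorm (hh : 0 < h) (hq : q ≠ 0) (φ : ℝ → ℂ) (α : ℕ) :
    gevreyRatio s h α * eLpNorm (iteratedDeriv α φ) q (intervalMeasure T) ≤ testNorm q s h T φ := by
  rcases eq_or_ne q ∞ with rfl | hq'
  · rw [testNorm, if_pos rfl]
    exact le_iSup (fun α => gevreyRatio s h α *
      eLpNorm (iteratedDeriv α φ) ∞ (intervalMeasure T)) α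
  · rw [testNorm_eq_tsum hh hq', one_div, ENNReal.le_rpow_inv_iff (ENNReal.toReal_pos hq hq')]
    exact ENNReal.le_tsum α

theorem TestSpace.memLp_iteratedDeriv (hh : 0 < h) (hq : q ≠ 0) {φ : ℝ → ℂ}
    (hφ : φ ∈ TestSpace q s h T) (α : ℕ) : MemLp (iteratedDeriv α φ) q (intervalMeasure T) := by
  have hcont : ContinuousOn (iteratedDeriv α φ) (Ioo 0 T) :=
    (hφ.1.continuousOn_iteratedDerivWithin (by exact_mod_cast le_top) isOpen_Ioo.uniqueDiffOn).congr
      fun t ht => (iteratedDerivWithin_of_isOpen isOpen_Ioo ht).symm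
  refine ⟨hcont.aestronglyMeasurable measurableSet_Ioo, lt_of_not_ge fun htop => ?_⟩
  have hle := gevreyRatio_mul_eLpNorm_le_testNorm (T := T) (s := s) hh hq φ α
  rw [top_le_iff.1 htop, ENNReal.mul_top (gevreyRatio_ne_zero hh α), top_le_iff] at hle
  exact hφ.2.ne hle

theorem tsum_eLpNorm_iteratedDeriv_mul_le [hqp : q.HolderConjugate p] (hp : p ≠ ∞) (hh : 0 < h)
    (φ : ℝ → ℂ) (a : ℕ → ℝ≥0∞) :
    ∑' α, eLpNorm (iteratedDeriv α φ) q (intervalMeasure T) * a α ≤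
      testNorm q s h T φ * gevreySum p s h a ^ (1 / p.toReal) := by
  have cancel : ∀ (α : ℕ) (x y : ℝ≥0∞),
      x * y = gevreyRatio s h α * x * ((gevreyRatio s h α)⁻¹ * y) := fun α x y => by
    rw [mul_mul_mul_comm, ENNReal.mul_inv_cancel (gevreyRatio_ne_zero hh α) (gevreyRatio_ne_top α),
      one_mul]
  rw [tsum_congr fun α => cancel α _ _, gevreySum_eq_tsum hh]
  rcases eq_or_ne q ∞ with rfl | hq
  · obtain rfl : p = 1 := ENNReal.HolderConjugate.unique ∞ p 1
    simp only [ENNReal.toReal_one, ENNReal.rpow_one, div_one, ← ENNReal.tsum_mul_left]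
    gcongr with α
    exact gevreyRatio_mul_eLpNorm_le_testNorm hh ENNReal.top_ne_zero φ α
  · have holder := ENNReal.lintegral_mul_le_Lp_mul_Lq (Measure.count : Measure ℕ)
      (ENNReal.HolderConjugate.toReal_of_ne_top hq hp)
      (f := fun α => gevreyRatio s h α * eLpNorm (iteratedDeriv α φ) q (intervalMeasure T))
      (g := fun α => (gevreyRatio s h α)⁻¹ * a α)
      (measurable_of_countable _).aemeasurable (measurable_of_countable _).aemeasurable
    simpa only [lintegral_count, Pi.mul_apply, testNorm_eq_tsum hh hq] using holder

variable [hqp : q.HolderConjugate p] {E : Type*} [NormedAddCommGroup E] [NormedSpace ℂ E]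
  {φ : ℝ → ℂ}

theorem TestSpace.integrable_iteratedDeriv_smul (hh : 0 < h) (hφ : φ ∈ TestSpace q s h T) (α : ℕ)
    {F : ℝ → E} (hF : MemLp F p (intervalMeasure T)) :
    Integrable (fun t => iteratedDeriv α φ t • F t) (intervalMeasure T) :=
  memLp_one_iff_integrable.1
    (hF.smul (TestSpace.memLp_iteratedDeriv hh (ENNReal.HolderConjugate.ne_zero q p) hφ α))

theorem TestSpace.enorm_integral_iteratedDeriv_smul_le (hh : 0 < h) (hφ : φ ∈ TestSpace q s h T)
    (α : ℕ) {F : ℝ → E} (hF : MemLp F p (intervalMeasure T)) :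
    ‖∫ t, iteratedDeriv α φ t • F t ∂intervalMeasure T‖ₑ ≤
      eLpNorm (iteratedDeriv α φ) q (intervalMeasure T) * eLpNorm F p (intervalMeasure T) := by
  refine (enorm_integral_le_lintegral_enorm _).trans ?_
  rw [← eLpNorm_one_eq_lintegral_enorm]
  exact eLpNorm_smul_le_mul_eLpNorm hF.aestronglyMeasurable
    (TestSpace.memLp_iteratedDeriv hh
      (ENNReal.HolderConjugate.ne_zero q p) hφ α).aestronglyMeasurable

theorem TestSpace.tsum_enorm_pairing_le (hp : p ≠ ∞) (hh : 0 < h) (hφ : φ ∈ TestSpace q s h T)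
    {F : ℕ → ℝ → E} (hF : ∀ α, MemLp (F α) p (intervalMeasure T)) :
    ∑' α : ℕ, ‖(-1 : ℂ) ^ α • ∫ t, iteratedDeriv α φ t • F α t ∂intervalMeasure T‖ₑ ≤
      testNorm q s h T φ * seqNorm p s h T F := by
  have enorm_sign_smul : ∀ (α : ℕ) (x : E), ‖(-1 : ℂ) ^ α • x‖ₑ = ‖x‖ₑ := fun α x => by
    rw [enorm_smul, enorm_pow, enorm_neg, enorm_one, one_pow, one_mul]
  simp only [enorm_sign_smul]
  exact (ENNReal.tsum_le_tsum fun α =>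
    TestSpace.enorm_integral_iteratedDeriv_smul_le hh hφ α (hF α)).trans
      (tsum_eLpNorm_iteratedDeriv_mul_le hp hh φ _)

theorem TestSpace.tendsto_norm_pairing (hp : p ≠ ∞) (hh : 0 < h) (hφ : φ ∈ TestSpace q s h T)
    {F : ℕ → ℕ → ℝ → E} (hF : ∀ k α, MemLp (F k α) p (intervalMeasure T))
    (hlim : Tendsto (fun k => seqNorm p s h T (F k)) atTop (𝓝 0)) :
    Tendsto (fun k => ‖pairing T (F k) φ‖) atTop (𝓝 0) := by
  have hbound : Tendsto (fun k => testNorm q s h T φ * seqNorm p s h T (F k)) atTop (𝓝 0) := by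
    simpa only [mul_zero] using ENNReal.Tendsto.const_mul hlim (.inr hφ.2.ne)
  have henorm : Tendsto (fun k => ‖pairing T (F k) φ‖ₑ) atTop (𝓝 0) :=
    tendsto_of_tendsto_of_tendsto_of_le_of_le tendsto_const_nhds hbound (fun _ => zero_le)
      fun k => enorm_tsum_le_tsum_enorm.trans (TestSpace.tsum_enorm_pairing_le hp hh hφ (hF k))
  simpa only [Function.comp_def, toReal_enorm, ENNReal.toReal_zero] using
    (ENNReal.tendsto_toReal ENNReal.zero_ne_top).comp henorm

theorem TestSpace.hasSum_pairing [CompleteSpace E] (hp : p ≠ ∞) (hh : 0 < h)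
    (hφ : φ ∈ TestSpace q s h T) {F : ℕ → ℝ → E}
    (hF : ∀ α, MemLp (F α) p (intervalMeasure T)) (hFn : seqNorm p s h T F < ∞) :
    HasSum (fun α : ℕ => (-1 : ℂ) ^ α • ∫ t, iteratedDeriv α φ t • F α t ∂intervalMeasure T)
      (pairing T F φ) :=
  (Summable.of_enorm ((TestSpace.tsum_enorm_pairing_le hp hh hφ hF).trans_lt
    (ENNReal.mul_lt_top hφ.2 hFn)).ne).hasSum

end Pairing

/-! ### Strict solutions and `F`-solutions -/

section Solutions

variable {E : Type*} [NormedAddCommGroup E] [NormedSpace ℂ E] {A : E →ₗ.[ℂ] E}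

/-- The resolvent `R(z : A)` as a bounded operator into the domain with the graph norm. -/
def IsResolventAt.toGraphDomain {z : ℂ} {R : E →L[ℂ] E} (hR : IsResolventAt A z R) :
    E →L[ℂ] GraphDomain A :=
  LinearMap.mkContinuous
    { toFun := fun x => (⟨R x, (hR.1 x).1⟩ : A.domain)
      map_add' := fun x y => Subtype.ext (map_add R x y)
      map_smul' := fun c x => Subtype.ext (map_smul R c x) }
    (‖R‖ + ‖z • R - .id ℂ E‖) fun x => by
      have hAR : A ⟨R x, (hR.1 x).1⟩ = (z • R - .id ℂ E) x :=
        (sub_eq_of_eq_add (sub_eq_iff_eq_add'.1 (hR.1 x).2)).symm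
      rw [GraphDomain.norm_eq, add_mul]
      change ‖R x‖ + ‖A ⟨R x, (hR.1 x).1⟩‖ ≤ _
      rw [hAR]
      exact add_le_add (R.le_opNorm x) (ContinuousLinearMap.le_opNorm _ x)

theorem IsResolventAt.toGraphDomain_apply {z : ℂ} {R : E →L[ℂ] E} (hR : IsResolventAt A z R)
    (x : E) : ((hR.toGraphDomain x).toDomain : E) = R x := rfl

theorem IsResolventAt.hasSum_mem_graph {ι : Type*} {z : ℂ} {R : E →L[ℂ] E}
    (hR : IsResolventAt A z R) {x y : ι → E} {a b : E} (hx : HasSum x a) (hy : HasSum y b)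
    (hxy : ∀ i, (x i, y i) ∈ A.graph) : (a, b) ∈ A.graph := by
  refine hR.mem_graph_iff.2 ((R.hasSum ((hx.const_smul z).sub hy)).unique ?_)
  simpa only [hR.apply_of_mem_graph (hxy _)] using hx

theorem IsResolventAt.integral_mem_graph [CompleteSpace E] {Ω : Type*} [MeasurableSpace Ω]
    {μ : Measure Ω} {z : ℂ} {R : E →L[ℂ] E} (hR : IsResolventAt A z R) {x y : Ω → E}
    (hx : Integrable x μ) (hy : Integrable y μ) (hxy : ∀ᵐ t ∂μ, (x t, y t) ∈ A.graph) :
    (∫ t, x t ∂μ, ∫ t, y t ∂μ) ∈ A.graph := by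
  have hzx : Integrable (fun t => z • x t) μ := hx.smul z
  have hzxy : Integrable (fun t => z • x t - y t) μ := hzx.sub hy
  rw [hR.mem_graph_iff, ← integral_smul, ← integral_sub hzx hy, ← R.integral_comp_comm hzxy]
  exact integral_congr_ae (hxy.mono fun t ht => hR.apply_of_mem_graph ht)

theorem HilleYosida.exists_isResolventAt {ω C : ℝ} (hHY : HilleYosida A ω C) :
    ∃ (z : ℂ) (R : E →L[ℂ] E), IsResolventAt A z R := by
  obtain ⟨R, hR, -⟩ := hHY (ω + 1) (lt_add_one ω)
  exact ⟨_, R, hR⟩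

variable {p : ℝ≥0∞} [Fact (1 ≤ p)] {s h T ω C : ℝ}

theorem IsResolventAt.ae_toGraphDomain_compLp_eq {z : ℂ} {R : E →L[ℂ] E}
    (hR : IsResolventAt A z R) {f : LpI E p T} {w : W1p E p T} (hw : SolvesAE A f w) :
    ∀ᵐ t ∂intervalMeasure T,
      ((hR.toGraphDomain.compLp (z • w.toLp - (w.der - f)) t).toDomain : E) = w t := by
  filter_upwards [hR.toGraphDomain.coeFn_compLp (z • w.toLp - (w.der - f)),
    Lp.coeFn_sub (z • w.toLp) (w.der - f), Lp.coeFn_smul z w.toLp, Lp.coeFn_sub w.der f,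
    w.coeFn_toLp, hw] with t hcomp hsub hsmul hder hwt hmem
  rw [hcomp, hR.toGraphDomain_apply, hsub, Pi.sub_apply, hsmul, hder, Pi.smul_apply,
    Pi.sub_apply, hwt]
  exact hR.apply_of_mem_graph hmem

theorem mem_seqW1pDom_of_solvesAE (hHY : HilleYosida A ω C) (hp : p ≠ ∞) {f : ℕ → LpI E p T}
    {u : ℕ → W1p E p T} (hf : f ∈ SeqLp E p s h T) (hu : u ∈ SeqW1p E p s h T)
    (hsol : ∀ α, SolvesAE A (f α) (u α)) : u ∈ SeqW1pDom A p s h T := by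
  obtain ⟨z, R, hR⟩ := hHY.exists_isResolventAt
  obtain ⟨hutoLp, huder⟩ := (mem_seqW1p_iff hp).1 hu
  refine ⟨hu, fun α => hR.toGraphDomain.compLp (z • (u α).toLp - ((u α).der - f α)),
    (mem_seqLp_iff hp).2 ?_, fun α => hR.ae_toGraphDomain_compLp_eq (hsol α)⟩
  have hder : gevreySum p s h (fun α => ‖(u α).der - f α‖ₑ) < ∞ :=
    gevreySum_lt_top_of_norm_le (K := 1) hp (fun α => by
      rw [NNReal.coe_one, one_mul]; exact norm_sub_le _ _) huder ((mem_seqLp_iff hp).1 hf)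
  refine gevreySum_lt_top_of_norm_le (K := ‖hR.toGraphDomain‖₊ * (1 + ‖z‖₊)) hp (fun α => ?_)
    hutoLp hder
  refine (ContinuousLinearMap.norm_compLp_le _ _).trans ?_
  push_cast
  rw [mul_assoc]
  gcongr
  refine (norm_sub_le _ _).trans ?_
  rw [norm_smul]
  nlinarith [norm_nonneg z, norm_nonneg (u α).toLp, norm_nonneg ((u α).der - f α)]

theorem isStrictSolution_iff (hHY : HilleYosida A ω C) (hp : p ≠ ∞) {f : ℕ → ℝ → E} {u₀ : ℕ → E}
    {u : ℕ → W1p E p T} (hf : ∀ α, MemLp (f α) p (intervalMeasure T))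
    (hfn : seqNorm p s h T f < ∞) : IsStrictSolution A p s h T f u₀ u ↔
      u ∈ SeqW1p E p s h T ∧ (∀ α, SolvesAE A (f α) (u α)) ∧ ∀ α, (u α).init = u₀ α := by
  simp only [IsStrictSolution, ← solvesAE_iff, W1p.apply_zero]
  refine ⟨fun ⟨hu, hsol⟩ => ⟨hu.1, hsol⟩, fun ⟨hu, hsol⟩ =>
    ⟨mem_seqW1pDom_of_solvesAE (f := fun α => (hf α).toLp) hHY hp ?_ hu fun α => ?_, hsol⟩⟩
  · exact (mem_seqLp_iff hp).2
      ((seqNorm_lt_top_iff_of_ae_eq hp fun α => (hf α).coeFn_toLp.symm).1 hfn)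
  · exact (hsol.1 α).congr (hf α).coeFn_toLp.symm

theorem isStrictSolution_indicator_Iio (hHY : HilleYosida A ω C) (hp : p ≠ ∞) {f : ℕ → LpI E p T}
    {u : ℕ → W1p E p T} (hu : ∀ α, SolvesAE A (f α) (u α)) (k : ℕ) :
    (Iio k).indicator f ∈ SeqLp E p s h T ∧
      IsStrictSolution A p s h T (fun α => ((Iio k).indicator f α : LpI E p T))
        ((Iio k).indicator fun α => (u α).init) ((Iio k).indicator u) := by
  have hf : (Iio k).indicator f ∈ SeqLp E p s h T :=
    (mem_seqLp_iff hp).2 (gevreySum_indicator_Iio_lt_top hp f k)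
  refine ⟨hf, (isStrictSolution_iff hHY hp (fun α => Lp.memLp _) hf).2
    ⟨(mem_seqW1p_iff hp).2 ⟨?_, ?_⟩, fun α => ?_, fun α => ?_⟩⟩
  · convert gevreySum_indicator_Iio_lt_top hp (fun α => (u α).toLp) k using 3 with α
    exact congrArg _ (congrFun (indicator_comp_of_zero W1p.toLp_zero) α).symm
  · convert gevreySum_indicator_Iio_lt_top hp (fun α => (u α).der) k using 3 with α
    exact congrArg _ (congrFun (indicator_comp_of_zero (g := W1p.der) rfl) α).symm
  · by_cases hα : α ∈ Iio k
    · simpa only [indicator_of_mem hα] using hu α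
    · simpa only [indicator_of_notMem hα] using SolvesAE.zero
  · exact (congrFun (indicator_comp_of_zero (g := W1p.init) rfl) α).symm

theorem tendsto_seqNorm_add_seqNorm_add_seqNorm_iff (hp : p ≠ ∞) (hT : 0 < T)
    {uk : ℕ → ℕ → W1p E p T} {fk : ℕ → ℕ → LpI E p T} {u₀k : ℕ → ℕ → E} {f u : ℕ → LpI E p T}
    {u₀ : ℕ → E} :
    Tendsto (fun k =>
        seqNorm p s h T (fun α t => uk k α t - u α t) +
        seqNorm p s h T (fun α t => fk k α t - f α t) +
        seqNorm p s h T (fun α _ => u₀k k α - u₀ α)) atTop (𝓝 0) ↔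
      Tendsto (fun k => gevreySum p s h fun α => ‖(uk k α).toLp - u α‖ₑ) atTop (𝓝 0) ∧
        Tendsto (fun k => gevreySum p s h fun α => ‖fk k α - f α‖ₑ) atTop (𝓝 0) ∧
        Tendsto (fun k => gevreySum p s h fun α => ‖u₀k k α - u₀ α‖ₑ) atTop (𝓝 0) := by
  have hu : ∀ k α, (fun t => uk k α t - u α t) =ᵐ[intervalMeasure T]
      ((uk k α).toLp - u α : LpI E p T) :=
    fun k α => ((uk k α).coeFn_toLp.symm.sub .rfl).trans (Lp.coeFn_sub _ _).symm
  have hf : ∀ k α, (fun t => fk k α t - f α t) =ᵐ[intervalMeasure T]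
      (fk k α - f α : LpI E p T) :=
    fun k α => (Lp.coeFn_sub _ _).symm
  rw [tendsto_add_add_nhds_zero_iff, tendsto_seqNorm_iff_of_ae_eq hp hu,
    tendsto_seqNorm_iff_of_ae_eq hp hf, tendsto_seqNorm_const_iff hp hT]

theorem IsFSolution.mem_topologicalClosure_strictGraph (hp : p ≠ ∞) (hh : 0 < h) (hT : 0 < T)
    {f u : ℕ → LpI E p T} {u₀ : ℕ → E} (hu : IsFSolution A p s h T (fun α => f α) u₀ u) (α : ℕ) :
    ((f α, u₀ α), u α) ∈ (strictGraph A p T).topologicalClosure := by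
  obtain ⟨-, uk, fk, u₀k, hk, hlim⟩ := hu
  obtain ⟨hulim, hflim, hu₀lim⟩ := (tendsto_seqNorm_add_seqNorm_add_seqNorm_iff hp hT).1 hlim
  have component : ∀ {X : Type _} [NormedAddCommGroup X] {x : ℕ → ℕ → X} {y : ℕ → X},
      Tendsto (fun k => gevreySum p s h fun α => ‖x k α - y α‖ₑ) atTop (𝓝 0) →
        Tendsto (fun k => x k α) atTop (𝓝 (y α)) := fun {X _ x y} hx => by
    simp only [tendsto_iff_edist_tendsto_0, edist_eq_enorm_sub]
    exact tendsto_apply_of_tendsto_weightedPowSum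
      (c := fun α => ENNReal.ofReal (weight p s h α)) (i := α) (toReal_pos hp)
      (ENNReal.ofReal_pos.2 (weight_pos hh α)).ne' ENNReal.ofReal_ne_top hx
  refine mem_closure_of_tendsto
    (((component hflim).prodMk_nhds (component hu₀lim)).prodMk_nhds (component hulim))
    (.of_forall fun k => ⟨uk k α, solvesAE_iff.2 ((hk k).2.2.1 α), ?_, rfl⟩)
  rw [← W1p.apply_zero, (hk k).2.2.2 α]

theorem exists_solvesAE_of_mem_topologicalClosure_strictGraph {f U : LpI E p T} {u₀ : E}
    (hU : ((f, u₀), U) ∈ (strictGraph A p T).topologicalClosure) {ε : ℝ≥0∞} (hε : 0 < ε) :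
    ∃ (g : LpI E p T) (w : W1p E p T), SolvesAE A g w ∧
      ‖w.toLp - U‖ₑ ≤ ε ∧ ‖g - f‖ₑ ≤ ε ∧ ‖w.init - u₀‖ₑ ≤ ε := by
  obtain ⟨⟨⟨g, _⟩, _⟩, ⟨w, hw, rfl, rfl⟩, hdist⟩ := EMetric.mem_closure_iff.1 hU ε hε
  rw [edist_comm, Prod.edist_eq, Prod.edist_eq, max_lt_iff, max_lt_iff] at hdist
  simp only [edist_eq_enorm_sub] at hdist
  exact ⟨g, w, hw, hdist.2.le, hdist.1.1.le, hdist.1.2.le⟩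

variable [CompleteSpace E]

theorem IsStrictSolution.isStrictWeakSolution {q : ℝ≥0∞} [q.HolderConjugate p]
    (hHY : HilleYosida A ω C) (hp : p ≠ ∞) (hh : 0 < h) {f : ℕ → ℝ → E} {u₀ : ℕ → E}
    {u : ℕ → W1p E p T} (hf : ∀ α, MemLp (f α) p (intervalMeasure T))
    (hfn : seqNorm p s h T f < ∞) (hu : IsStrictSolution A p s h T f u₀ u) :
    IsStrictWeakSolution A p q s h T f u₀ u := by
  refine ⟨hu.1, fun φ hφ => mem_graph_sub_iff.1 ?_, hu.2.2⟩
  obtain ⟨z, R, hR⟩ := hHY.exists_isResolventAt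
  have huder := ((mem_seqW1p_iff hp).1 hu.1.1).2
  have humem : ∀ α, MemLp (u α) p (intervalMeasure T) := fun α =>
    memLp_of_continuousOn_Icc (u α).continuousOn
  have hdermem : ∀ α, MemLp (u α).der p (intervalMeasure T) := fun α => Lp.memLp _
  refine hR.hasSum_mem_graph
    (TestSpace.hasSum_pairing hp hh hφ humem (seqNorm_lt_top_of_mem_seqW1p hp hu.1.1))
    ((TestSpace.hasSum_pairing hp hh hφ hdermem ((mem_seqLp_iff hp).2 huder)).sub
      (TestSpace.hasSum_pairing hp hh hφ hf hfn)) fun α => ?_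
  have hint : ∀ {F : ℝ → E}, MemLp F p (intervalMeasure T) →
      Integrable (fun t => iteratedDeriv α φ t • F t) (intervalMeasure T) :=
    TestSpace.integrable_iteratedDeriv_smul hh hφ α
  rw [← smul_sub, ← integral_sub (hint (hdermem α)) (hint (hf α))]
  refine A.graph.smul_mem _ (hR.integral_mem_graph (hint (humem α))
    ((hint (hdermem α)).sub (hint (hf α))) ?_)
  filter_upwards [solvesAE_iff.2 (hu.2.1 α)] with t hmem
  change (iteratedDeriv α φ t • u α t,
    iteratedDeriv α φ t • (u α).der t - iteratedDeriv α φ t • f α t) ∈ A.graph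
  rw [← smul_sub]
  exact A.graph.smul_mem _ hmem

theorem IsFSolution.isFWeakSolution {q : ℝ≥0∞} [q.HolderConjugate p] (hHY : HilleYosida A ω C)
    (hp : p ≠ ∞) (hh : 0 < h) {f u : ℕ → LpI E p T} {u₀ : ℕ → E}
    (hu : IsFSolution A p s h T (fun α => f α) u₀ u) :
    IsFWeakSolution A p q s h T (fun α => f α) u₀ u := by
  obtain ⟨hu, uk, fk, u₀k, hk, hlim⟩ := hu
  obtain ⟨hulim, hflim, hu₀lim⟩ := tendsto_add_add_nhds_zero_iff.1 hlim
  refine ⟨hu, uk, fk, u₀k, fun k => ⟨(hk k).1,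
    (hk k).2.isStrictWeakSolution hHY hp hh (fun α => Lp.memLp _) (hk k).1⟩, fun φ hφ => ?_⟩
  have hupair := TestSpace.tendsto_norm_pairing (F := fun k α t => uk k α t - u α t) hp hh hφ
    (fun k α => (memLp_of_continuousOn_Icc (uk k α).continuousOn).sub (Lp.memLp (u α))) hulim
  have hfpair := TestSpace.tendsto_norm_pairing (F := fun k α t => fk k α t - f α t) hp hh hφ
    (fun k α => (Lp.memLp (fk k α)).sub (Lp.memLp (f α))) hflim
  have hu₀pair := TestSpace.tendsto_norm_pairing (F := fun k α _ => u₀k k α - u₀ α) hp hh hφ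
    (fun k α => memLp_const (u₀k k α - u₀ α)) hu₀lim
  simpa only [add_zero] using (hupair.add hfpair).add hu₀pair

theorem IsFSolution.unique (hHY : HilleYosida A ω C) (hp : p ≠ ∞) (hh : 0 < h) (hT : 0 < T)
    {f u v : ℕ → LpI E p T} {u₀ : ℕ → E} (hu : IsFSolution A p s h T (fun α => f α) u₀ u)
    (hv : IsFSolution A p s h T (fun α => f α) u₀ v) : u = v :=
  funext fun α => eq_of_mem_topologicalClosure_strictGraph hHY
    (hu.mem_topologicalClosure_strictGraph hp hh hT α)
    (hv.mem_topologicalClosure_strictGraph hp hh hT α)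

theorem mem_seqLp_of_mem_topologicalClosure_strictGraph (hHY : HilleYosida A ω C) (hp : p ≠ ∞)
    {f U : ℕ → LpI E p T} {u₀ : ℕ → E} (hf : f ∈ SeqLp E p s h T)
    (hu₀ : gevreySum p s h (fun α => ‖u₀ α‖ₑ) < ∞)
    (hU : ∀ α, ((f α, u₀ α), U α) ∈ (strictGraph A p T).topologicalClosure) :
    U ∈ SeqLp E p s h T := by
  obtain ⟨K, hK⟩ := hHY.exists_norm_le_of_mem_topologicalClosure p T
  refine (mem_seqLp_iff hp).2 (gevreySum_lt_top_of_norm_le (K := K) hp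
    (fun α => (hK _ (hU α)).trans ?_)
    ((mem_seqLp_iff hp).1 hf) hu₀)
  gcongr
  exact max_le_add_of_nonneg (norm_nonneg _) (norm_nonneg _)

theorem isFSolution_of_mem_topologicalClosure_strictGraph (hHY : HilleYosida A ω C) (hp : p ≠ ∞)
    (hT : 0 < T) {f U : ℕ → LpI E p T} {u₀ : ℕ → E} (hf : f ∈ SeqLp E p s h T)
    (hu₀ : gevreySum p s h (fun α => ‖u₀ α‖ₑ) < ∞)
    (hU : ∀ α, ((f α, u₀ α), U α) ∈ (strictGraph A p T).topologicalClosure) :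
    IsFSolution A p s h T (fun α => f α) u₀ U := by
  have hUmem := mem_seqLp_of_mem_topologicalClosure_strictGraph hHY hp hf hu₀ hU
  obtain ⟨δ, hδ, hδlim⟩ := exists_pos_tendsto_weightedPowSum
    (c := fun α => ENNReal.ofReal (weight p s h α)) (toReal_pos hp) fun _ => ENNReal.ofReal_ne_top
  choose g w hsol hw hg hinit using fun k α =>
    exists_solvesAE_of_mem_topologicalClosure_strictGraph (hU α) (hδ k α)
  refine ⟨hUmem, fun k => (Iio k).indicator (w k), fun k => (Iio k).indicator (g k),
    fun k => (Iio k).indicator fun α => (w k α).init,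
    fun k => isStrictSolution_indicator_Iio hHY hp (hsol k) k,
    (tendsto_seqNorm_add_seqNorm_add_seqNorm_iff hp hT).2 ⟨?_, ?_, ?_⟩⟩
  · convert tendsto_gevreySum_indicator_Iio_sub ((mem_seqLp_iff hp).1 hUmem) hδlim hw using 5 with
      k α
    exact congrArg (· - U α) (congrFun (indicator_comp_of_zero W1p.toLp_zero) α).symm
  · exact tendsto_gevreySum_indicator_Iio_sub ((mem_seqLp_iff hp).1 hf) hδlim hg
  · exact tendsto_gevreySum_indicator_Iio_sub hu₀ hδlim hinit

theorem exists_isFSolution (hHY : HilleYosida A ω C) (hA : A.IsClosed) (hp : p ≠ ∞) (hh : 0 < h)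
    (hT : 0 < T) {f : ℕ → LpI E p T} {u₀ : ℕ → E} (hf : f ∈ SeqLp E p s h T)
    (hu₀ : WeightedSummable p s h u₀) (hcl : ∀ α, u₀ α ∈ closure (A.domain : Set E)) :
    ∃ u, IsFSolution A p s h T (fun α => f α) u₀ u := by
  choose U hU using fun α =>
    exists_mem_topologicalClosure_strictGraph hHY hA hp hT (f α) (hcl α)
  exact ⟨U, isFSolution_of_mem_topologicalClosure_strictGraph hHY hp hT hf
    (hu₀.gevreySum_lt_top hh) hU⟩

theorem exists_isStrictSolution (hHY : HilleYosida A ω C) (hA : A.IsClosed) (hp : p ≠ ∞)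
    (hh : 0 < h) (hT : 0 < T) {f : ℕ → W1p E p T} {u₀ : ℕ → A.domain}
    (hf : f ∈ SeqW1p E p s h T) (hcl : ∀ α, A (u₀ α) + f α 0 ∈ closure (A.domain : Set E))
    (hu₀ : WeightedSummable p s h (fun α => (u₀ α : E)))
    (hAu₀ : WeightedSummable p s h (fun α => A (u₀ α))) :
    ∃ u, IsStrictSolution A p s h T (fun α => f α) (fun α => (u₀ α : E)) u := by
  obtain ⟨K, hK⟩ := hHY.exists_solvesAE hA p hT
  obtain ⟨L, hL⟩ := hHY.exists_norm_toLp_le p T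
  obtain ⟨hftoLp, hfder⟩ := (mem_seqW1p_iff hp).1 hf
  simp only [W1p.apply_zero] at hcl
  choose u hinit hsol hder using fun α => hK (f α) (u₀ α) _ (A.mem_graph (u₀ α)) (hcl α)
  have htoLp : ∀ α, ‖(u α).toLp‖ ≤ L * (‖(u₀ α : E)‖ + ‖(f α).toLp‖) := fun α =>
    hinit α ▸ hL _ _ ((hsol α).congr (f α).coeFn_toLp.symm)
  have hsum : gevreySum p s h (fun α => ‖‖(f α).toLp‖ + ‖(f α).der‖‖ₑ) < ∞ :=
    gevreySum_lt_top_of_norm_le (K := 1) hp (fun α => by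
      rw [NNReal.coe_one, one_mul, Real.norm_of_nonneg (by positivity)]) hftoLp hfder
  refine ⟨u, (isStrictSolution_iff hHY hp
    (fun α => memLp_of_continuousOn_Icc (f α).continuousOn)
    (seqNorm_lt_top_of_mem_seqW1p hp hf)).2 ⟨(mem_seqW1p_iff hp).2 ⟨?_, ?_⟩, hsol, hinit⟩⟩
  · exact gevreySum_lt_top_of_norm_le hp htoLp (hu₀.gevreySum_lt_top hh) hftoLp
  · refine gevreySum_lt_top_of_norm_le (K := K) hp (fun α => (hder α).trans_eq ?_)
      (hAu₀.gevreySum_lt_top hh) hsum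
    rw [Real.norm_of_nonneg (by positivity)]

theorem IsStrictSolution.unique (hHY : HilleYosida A ω C) (hT : 0 < T) {f : ℕ → ℝ → E}
    {u₀ : ℕ → E} {u v : ℕ → W1p E p T} (hu : IsStrictSolution A p s h T f u₀ u)
    (hv : IsStrictSolution A p s h T f u₀ v) : u = v :=
  funext fun α => (solvesAE_iff.2 (hu.2.1 α)).unique hHY hT (solvesAE_iff.2 (hv.2.1 α)) <| by
    rw [← W1p.apply_zero, ← W1p.apply_zero, hu.2.2, hv.2.2]

end Solutions

end UltraCauchy

end

theorem mainTheorem3_general {E : Type*} [NormedAddCommGroup E] [NormedSpace ℂ E] [CompleteSpace E]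
    (A : E →ₗ.[ℂ] E) (hA : A.IsClosed) (ω C : ℝ) (hHY : UltraCauchy.HilleYosida A ω C)
    (p q : ℝ≥0∞) (hp : 1 ≤ p) (hp' : p ≠ ∞) (hpq : p⁻¹ + q⁻¹ = 1)
    (s h T : ℝ) (hh : 0 < h) (hT : 0 < T) :
    (∀ (f : ℕ → UltraCauchy.LpI E p T) (u₀ : ℕ → E),
      f ∈ UltraCauchy.SeqLp E p s h T →
      UltraCauchy.WeightedSummable p s h u₀ →
      (∀ α, u₀ α ∈ closure (A.domain : Set E)) →
      ∃ u : ℕ → UltraCauchy.LpI E p T,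
        UltraCauchy.IsFSolution A p s h T (fun α => f α) u₀ u ∧
        UltraCauchy.IsFWeakSolution A p q s h T (fun α => f α) u₀ u ∧
        ∀ v : ℕ → UltraCauchy.LpI E p T,
          UltraCauchy.IsFSolution A p s h T (fun α => f α) u₀ v → v = u) ∧
    (∀ (f : ℕ → UltraCauchy.W1p E p T) (u₀ : ℕ → A.domain),
      f ∈ UltraCauchy.SeqW1p E p s h T →
      (∀ α, A (u₀ α) + f α 0 ∈ closure (A.domain : Set E)) →
      UltraCauchy.WeightedSummable p s h (fun α => (u₀ α : E)) →
      UltraCauchy.WeightedSummable p s h (fun α => A (u₀ α)) →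
      ∃ u : ℕ → UltraCauchy.W1p E p T,
        UltraCauchy.IsStrictSolution A p s h T (fun α => f α) (fun α => (u₀ α : E)) u ∧
        UltraCauchy.IsStrictWeakSolution A p q s h T (fun α => f α) (fun α => (u₀ α : E)) u ∧
        ∀ v : ℕ → UltraCauchy.W1p E p T,
          UltraCauchy.IsStrictSolution A p s h T (fun α => f α) (fun α => (u₀ α : E)) v →
            v = u) := by
  have : Fact (1 ≤ p) := ⟨hp⟩
  have : q.HolderConjugate p := ENNReal.holderConjugate_iff.2 (by rw [add_comm, hpq])
  refine ⟨fun f u₀ hf hu₀ hcl => ?_, fun f u₀ hf hcl hu₀ hAu₀ => ?_⟩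
  · obtain ⟨u, hu⟩ := UltraCauchy.exists_isFSolution hHY hA hp' hh hT hf hu₀ hcl
    exact ⟨u, hu, hu.isFWeakSolution hHY hp' hh, fun v hv => hv.unique hHY hp' hh hT hu⟩
  · obtain ⟨u, hu⟩ := UltraCauchy.exists_isStrictSolution hHY hA hp' hh hT hf hcl hu₀ hAu₀
    exact ⟨u, hu, hu.isStrictWeakSolution hHY hp' hh
      (fun α => UltraCauchy.memLp_of_continuousOn_Icc (f α).continuousOn)
      (UltraCauchy.seqNorm_lt_top_of_mem_seqW1p hp' hf), fun v hv => hv.unique hHY hT hu⟩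

theorem mainTheorem3 {E : Type*} [NormedAddCommGroup E] [NormedSpace ℂ E] [CompleteSpace E]
    (A : E →ₗ.[ℂ] E) (hA : A.IsClosed) (ω C : ℝ) (hHY : UltraCauchy.HilleYosida A ω C)
    (p q : ℝ≥0∞) (hp : 1 ≤ p) (hp' : p ≠ ∞) (hpq : p⁻¹ + q⁻¹ = 1)
    (s h T : ℝ) (hs : 1 < s) (hh : 0 < h) (hT : 0 < T) :
    (∀ (f : ℕ → UltraCauchy.LpI E p T) (u₀ : ℕ → E),
      f ∈ UltraCauchy.SeqLp E p s h T →
      UltraCauchy.WeightedSummable p s h u₀ →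
      (∀ α, u₀ α ∈ closure (A.domain : Set E)) →
      ∃ u : ℕ → UltraCauchy.LpI E p T,
        UltraCauchy.IsFSolution A p s h T (fun α => f α) u₀ u ∧
        UltraCauchy.IsFWeakSolution A p q s h T (fun α => f α) u₀ u ∧
        ∀ v : ℕ → UltraCauchy.LpI E p T,
          UltraCauchy.IsFSolution A p s h T (fun α => f α) u₀ v → v = u) ∧
    (∀ (f : ℕ → UltraCauchy.W1p E p T) (u₀ : ℕ → A.domain),
      f ∈ UltraCauchy.SeqW1p E p s h T →
      (∀ α, A (u₀ α) + f α 0 ∈ closure (A.domain : Set E)) →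
      UltraCauchy.WeightedSummable p s h (fun α => (u₀ α : E)) →
      UltraCauchy.WeightedSummable p s h (fun α => A (u₀ α)) →
      ∃ u : ℕ → UltraCauchy.W1p E p T,
        UltraCauchy.IsStrictSolution A p s h T (fun α => f α) (fun α => (u₀ α : E)) u ∧
        UltraCauchy.IsStrictWeakSolution A p q s h T (fun α => f α) (fun α => (u₀ α : E)) u ∧
        ∀ v : ℕ → UltraCauchy.W1p E p T,
          UltraCauchy.IsStrictSolution A p s h T (fun α => f α) (fun α => (u₀ α : E)) v →
            v = u) :=
  mainTheorem3_general A hA ω C hHY p q hp hp' hpq s h T hh hT
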